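/- **Setting.** Let $\mathcal G=(\mathbb V,\mathcal E)$ be a connected, locally finite simple graph on a countable vertex set with at least two vertices, with symmetric positive conductances $a_{x,y}=a_{y,x}$ on its edges. Put $a_x=\sum_{z\sim x}a_{x,z}$, and let $P_x$ be the law of the Markov chain $X$ started at $x$ with transition probabilities $p_{x,y}=a_{x,y}/a_x$ for $x\sim y$ and $p_{x,y}=0$ otherwise. Assume that $X$ is transient. For a finite $K\subset\mathbb V$ let $\tau_K^+=\inf\{n\ge 1: X_n\in K\}$ and let $e_K(x)=a_xP_x[\tau_K^+=\infty]$ for $x\in K$. Let $W$ be the set of nearest-neighbour trajectories $w=(w_n)_{n\in\mathbb Z}$ in $\mathcal G$ that visit each vertex finitely often, with the $\sigma$-algebra generated by the coordinates. Let $W_K\subset W$ be the set of trajectories that hit $K$. Let $\pi^*:W\to W^*$ be the quotient by time shifts, let $W^*$ carry the quotient $\sigma$-algebra $\mathcal W^*$, and put $W^*_K=\pi^*(W_K)$. Let $\nu_K$ be the measure on $W$ concentrated on $\{w_0\in K\}$ with $$\nu_K\big((w_{-n})_{n\ge 0}\in A,\ w_0=x,\ (w_n)_{n\ge 0}\in B\big)=P_x[A\mid\tau_K^+=\infty]\,e_K(x)\,P_x[B]\qquad(x\in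 K),$$ the right-hand side being $0$ if $e_K(x)=0$. Fix any exhaustion $\emptyset=K_0\subset K_1\subset K_2\subset\cdots$ of $\mathbb V$ by finite sets, and let $$\nu=\Big(\sum_{n\ge1}\nu_{K_n}\mathbf 1_{W_{K_n}\setminus W_{K_{n-1}}}\Big)\circ(\pi^*)^{-1}.$$ Let $\Omega$ be the set of countable sums $\omega=\sum_i\delta_{w_i^*}$ of Dirac masses on $W^*$ such that $\omega(W_K^*)<\infty$ for every finite $K$. Equip $\Omega$ with the $\sigma$-algebra $\mathcal A$ generated by the maps $\omega\mapsto\omega(D)$, $D\in\mathcal W^*$, and with the order $\omega\le\omega'$ if and only if $\omega(D)\le\omega'(D)$ for all $D\in\mathcal W^*$. A probability measure $P$ on a measurable space equipped with an order satisfies the FKG inequality if $P[A\cap B]\ge P[A]P[B]$ for all measurable increasing sets $A,B$. A random variable satisfies it if its law does. **Theorem.** There is exactly one probability measure $\mathbb P$ on $(\Omega,\mathcal A)$ under which $\omega$ is a Poisson point process on $W^*$ with intensity measure $\nu$, and $\mathbb P$ satisfies the FKG inequality. Consequently, under $\mathbb P$, the following are measurable functions of $\omega$ and satisfy the FKG inequality: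 1. the interlacement set $\mathcal I=\bigcup_i\mathrm{Range}(w_i^*)$ and the vacant set $\mathcal V=\mathbb V\setminus\mathcal I$, as random subsets of $\mathbb V$ ordered by inclusion; 2. the family $(\eta_x)_{x\in\mathbb V}\in\mathbb N_0^{\mathbb V}$, where $\eta_x$ is the number of trajectories in $\omega$ visiting $x$; 3. the family $(\eta_x)_{x\in\mathbb V}\in\mathbb N_0^{\mathbb V}$, where $\eta_x$ is the total number of visits to $x$ by the trajectories in $\omega$. In 2 and 3, $\mathbb N_0^{\mathbb V}$ carries the product order. -/

import Mathlib

open MeasureTheory ProbabilityTheory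
open scoped ENNReal NNReal

/-- A probability measure on an ordered measurable space satisfies the FKG inequality if any two
measurable increasing events are positively correlated. -/
def SatisfiesFKG {α : Type*} [MeasurableSpace α] [Preorder α] (P : Measure α) : Prop :=
  ∀ A B : Set α, MeasurableSet A → MeasurableSet B → IsUpperSet A → IsUpperSet B →
    P A * P B ≤ P (A ∩ B)

/-- A random variable satisfies the FKG inequality if it is measurable and its law satisfies the
FKG inequality. -/
def VariableSatisfiesFKG {Ω α : Type*} [MeasurableSpace Ω] [MeasurableSpace α] [Preorder α]
    (f : Ω → α) (P : Measure Ω) : Prop :=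
  Measurable f ∧ SatisfiesFKG (P.map f)

/-- Under the probability measure `P`, the random measure `ξ` is a Poisson point process with
intensity measure `ν`: the mass of every measurable set `D` has the Poisson distribution with
parameter `ν D` (the Dirac mass at `∞` if `ν D = ∞`), and the masses of finitely many pairwise
disjoint measurable sets are independent. -/
structure IsPoissonPointProcess {Ω X : Type*} [MeasurableSpace Ω] [MeasurableSpace X]
    (ν : Measure X) (ξ : Ω → Measure X) (P : Measure Ω) : Prop where
  isProbabilityMeasure : IsProbabilityMeasure P
  measurable : Measurable ξ
  map_apply_eq_poisson : ∀ D : Set X, MeasurableSet D → ν D ≠ ∞ →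
    P.map (fun ω => ξ ω D) =
      (poissonMeasure (ν D).toNNReal).map (fun n : ℕ => (n : ℝ≥0∞))
  ae_apply_eq_top : ∀ D : Set X, MeasurableSet D → ν D = ∞ → ∀ᵐ ω ∂P, ξ ω D = ∞
  iIndepFun_apply : ∀ (m : ℕ) (D : Fin m → Set X), (∀ i, MeasurableSet (D i)) →
    Pairwise (fun i j => Disjoint (D i) (D j)) → iIndepFun (fun i ω => ξ ω (D i)) P

/-- A connected, locally finite simple graph with symmetric positive conductances on its edges,
extended by `0` to all other pairs of vertices. -/
structure WeightedNetwork (V : Type*) where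
  graph : SimpleGraph V
  conductance : V → V → ℝ≥0
  conductance_symm : ∀ x y, conductance x y = conductance y x
  conductance_pos_iff : ∀ x y, 0 < conductance x y ↔ graph.Adj x y
  connected : graph.Connected
  locallyFinite : ∀ x, (graph.neighborSet x).Finite

namespace WeightedNetwork

variable {V : Type*} (N : WeightedNetwork V)

/-! ### The Markov chain -/

/-- The total conductance `a_x` at a vertex. -/
noncomputable def totalConductance (x : V) : ℝ≥0 :=
  ∑ z ∈ (N.locallyFinite x).toFinset, N.conductance x z

/-- The transition probability `p_{x,y} = a_{x,y} / a_x`. It vanishes if `x` and `y` are not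
adjacent. -/
noncomputable def transitionProb (x y : V) : ℝ≥0 :=
  N.conductance x y / N.totalConductance x

theorem totalConductance_pos [Nontrivial V] (x : V) : 0 < N.totalConductance x := by
  obtain ⟨y, hy⟩ := N.connected.preconnected.exists_adj_of_nontrivial x
  refine lt_of_lt_of_le ((N.conductance_pos_iff x y).2 hy) ?_
  exact Finset.single_le_sum (f := fun z => N.conductance x z) (fun _ _ => zero_le) (by simpa using hy)

/-! ### Trajectories -/

/-- The space `W` of doubly infinite nearest-neighbour trajectories that visit every vertex only
finitely often, with the `σ`-algebra generated by the coordinate maps. -/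
def Trajectory : Type _ :=
  {w : ℤ → V // (∀ n, N.graph.Adj (w n) (w (n + 1))) ∧ ∀ x, {n | w n = x}.Finite}

instance [MeasurableSpace V] : MeasurableSpace N.Trajectory :=
  inferInstanceAs (MeasurableSpace
    {w : ℤ → V // (∀ n, N.graph.Adj (w n) (w (n + 1))) ∧ ∀ x, {n | w n = x}.Finite})

/-- Two trajectories are equivalent if they differ by a time shift. -/
instance shiftSetoid : Setoid N.Trajectory where
  r w w' := ∃ k : ℤ, ∀ n, w.1 (n + k) = w'.1 n
  iseqv :=
    { refl := fun w => ⟨0, fun n => by simp⟩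
      symm := fun {w w'} ⟨k, hk⟩ => ⟨-k, fun n => by rw [← hk]; simp⟩
      trans := fun {w w' w''} ⟨k, hk⟩ ⟨l, hl⟩ =>
        ⟨l + k, fun n => by rw [← hl, ← hk, add_assoc]⟩ }

/-- The space `W*` of trajectories modulo time shift, with the quotient `σ`-algebra. -/
def TrajectoryClass : Type _ := Quotient N.shiftSetoid

instance [MeasurableSpace V] : MeasurableSpace N.TrajectoryClass :=
  inferInstanceAs (MeasurableSpace (Quotient N.shiftSetoid))

/-- The projection `π* : W → W*`. -/
def proj (w : N.Trajectory) : N.TrajectoryClass := Quotient.mk _ w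

/-- The set `W_K` of trajectories that hit `K`. -/
def hitting (K : Set V) : Set N.Trajectory := {w | ∃ n, w.1 n ∈ K}

/-- The set `W*_K` of trajectories modulo time shift that hit `K`. -/
def hittingClass (K : Set V) : Set N.TrajectoryClass := N.proj '' N.hitting K

/-- The number of visits to `x` of a trajectory modulo time shift. -/
noncomputable def visits (x : V) : N.TrajectoryClass → ℕ :=
  Quotient.lift (fun w : N.Trajectory => {n | w.1 n = x}.ncard) (by
    rintro w w' ⟨k, hk⟩
    refine (Set.ncard_congr (fun n _ => n + k) ?_ ?_ ?_).symm
    · intro n hn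
      exact (hk n).trans hn
    · intro a b _ _ h
      exact add_right_cancel h
    · intro b hb
      refine ⟨b - k, ?_, by simp⟩
      change w'.1 (b - k) = x
      rw [← hk]
      simpa using hb)

/-- The range of a trajectory modulo time shift. -/
def range : N.TrajectoryClass → Set V :=
  Quotient.lift (fun w : N.Trajectory => Set.range w.1) (by
    rintro w w' ⟨k, hk⟩
    ext x
    constructor
    · rintro ⟨n, rfl⟩
      exact ⟨n - k, by rw [← hk]; simp⟩
    · rintro ⟨n, rfl⟩
      exact ⟨n + k, hk n⟩)

/-! ### The Markov chain -/

section Chain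

variable [Nontrivial V] [Countable V] [MeasurableSpace V] [DiscreteMeasurableSpace V]

/-- One step of the chain: from `x`, the next position has law `∑ y ~ x, p_{x,y} δ_y`. -/
noncomputable def step : Kernel V V where
  toFun x := ∑ y ∈ (N.locallyFinite x).toFinset, (N.transitionProb x y : ℝ≥0∞) • Measure.dirac y
  measurable' := measurable_of_countable _

instance : IsMarkovKernel N.step where
  isProbabilityMeasure x := by
    refine ⟨?_⟩
    change (∑ y ∈ (N.locallyFinite x).toFinset,
      (N.transitionProb x y : ℝ≥0∞) • Measure.dirac y : Measure V) Set.univ = 1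
    simp only [Measure.coe_finsetSum, Finset.sum_apply, Measure.smul_apply, measure_univ,
      smul_eq_mul, mul_one]
    rw [← ENNReal.ofNNReal_finsetSum, ENNReal.coe_eq_one]
    simp only [transitionProb, ← Finset.sum_div]
    exact div_self (N.totalConductance_pos x).ne'

/-- The law `P_x` of the Markov chain started from `x`. -/
noncomputable def chainLaw (x : V) : Measure (ℕ → V) :=
  Kernel.trajMeasure (X := fun _ => V) (Measure.dirac x)
    (fun n => N.step.comap (fun h : (i : Finset.Iic n) → V => h ⟨n, by simp⟩)
      (measurable_pi_apply _))

/-- The event that the return time `τ_K⁺ = inf {n ≥ 1 : X_n ∈ K}` is infinite. -/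
def noReturn (K : Set V) : Set (ℕ → V) := {w | ∀ n, 1 ≤ n → w n ∉ K}

/-- The chain is transient: from every vertex, with positive probability it never returns. -/
def IsTransient : Prop := ∀ x, 0 < N.chainLaw x (noReturn {x})

/-- The equilibrium measure `e_K(x) = a_x P_x[τ_K⁺ = ∞]`, for `x ∈ K`. -/
noncomputable def equilibrium (K : Finset V) (x : V) : ℝ≥0∞ :=
  N.totalConductance x * N.chainLaw x (noReturn K)


/-! ### The intensity measure -/

/-- The doubly infinite sequence with past `u` (reversed in time) and future `v`. -/
def glue (p : (ℕ → V) × (ℕ → V)) : ℤ → V :=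
  fun n => if 0 ≤ n then p.2 n.toNat else p.1 (-n).toNat

/-- The finite measure `ν_K` on `W`: the position at time `0` is chosen according to the equilibrium
measure `e_K`; given that it is `x`, the past, run backwards in time, has law
`P_x[ · | τ_K⁺ = ∞]` and the future has law `P_x`, independently. -/
noncomputable def localIntensity (K : Finset V) : Measure N.Trajectory :=
  (∑ x ∈ K, N.equilibrium K x •
    ((cond (N.chainLaw x) (noReturn K)).prod (N.chainLaw x)).map glue).comap Subtype.val

/-- The intensity measure `ν` on `W*`, built along an exhaustion `K 0 = ∅ ⊆ K 1 ⊆ K 2 ⊆ ⋯`: the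
image under `π*` of `∑ n ≥ 1, ν_{K n}` restricted to `W_{K n} \ W_{K (n - 1)}`. -/
noncomputable def intensity (K : ℕ → Finset V) : Measure N.TrajectoryClass :=
  (Measure.sum fun n => (N.localIntensity (K (n + 1))).restrict
    (N.hitting (K (n + 1)) \ N.hitting (K n))).map N.proj

end Chain

/-! ### Configurations -/

section Configuration

variable [MeasurableSpace V]

/-- The space `Ω` of locally finite point measures on `W*`: countable sums of Dirac masses that give
finite mass to `W*_K` for every finite `K`. It carries the `σ`-algebra generated by the maps
`ω ↦ ω D`, and the order `ω ≤ ω'` iff `ω D ≤ ω' D` for all measurable `D`. -/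
def Configuration : Type _ :=
  {ω : Measure N.TrajectoryClass //
    (∃ (I : Set ℕ) (w : I → N.TrajectoryClass), ω = Measure.sum fun i => Measure.dirac (w i)) ∧
    ∀ K : Finset V, ω (N.hittingClass K) < ∞}

instance : MeasurableSpace N.Configuration :=
  inferInstanceAs (MeasurableSpace {ω : Measure N.TrajectoryClass //
    (∃ (I : Set ℕ) (w : I → N.TrajectoryClass), ω = Measure.sum fun i => Measure.dirac (w i)) ∧
    ∀ K : Finset V, ω (N.hittingClass K) < ∞})

instance : PartialOrder N.Configuration :=
  inferInstanceAs (PartialOrder {ω : Measure N.TrajectoryClass //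
    (∃ (I : Set ℕ) (w : I → N.TrajectoryClass), ω = Measure.sum fun i => Measure.dirac (w i)) ∧
    ∀ K : Finset V, ω (N.hittingClass K) < ∞})

theorem Configuration.le_iff {N : WeightedNetwork V} {ω ω' : N.Configuration} :
    ω ≤ ω' ↔ ∀ D, MeasurableSet D → ω.1 D ≤ ω'.1 D :=
  Measure.le_iff

/-- The interlacement set: the union of the ranges of the trajectories in `ω`. -/
def interlacementSet (ω : N.Configuration) : Set V := ⋃ γ ∈ {γ | ω.1 {γ} ≠ 0}, N.range γ

/-- The vacant set. -/
def vacantSet (ω : N.Configuration) : Set V := (N.interlacementSet ω)ᶜ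

/-- The number of trajectories in `ω` visiting `x`, that is `ω (W*_{x})`. -/
noncomputable def trajectoryCount (ω : N.Configuration) (x : V) : ℕ :=
  ⌊(ω.1 (N.hittingClass {x})).toReal⌋₊

/-- The total number of visits to `x` by the trajectories in `ω`. -/
noncomputable def localTime (ω : N.Configuration) (x : V) : ℕ :=
  ⌊(∫⁻ γ, N.visits x γ ∂ω.1).toReal⌋₊

end Configuration

end WeightedNetwork

/-! The FKG inequality holds for the Poisson process because such a process is a superposition of
arbitrarily many independent, almost empty pieces. Let `ν` be a finite intensity of mass `m`. A
Poisson process of intensity `ν` is nonempty with probability at most `m`, and a law with mass at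
most `r` off a least element satisfies the inequality for monotone functions into [0,1] up to an
error `r ^ 2` (`fkgUpTo_of_real_le`). Errors add under independent products (`FKGUpTo.prod`) and
survive monotone maps, of which the sum of point measures is one. Splitting `ν` into `2 ^ k` equal
parts therefore gives the error `2 ^ k * (m / 2 ^ k) ^ 2 = m ^ 2 / 2 ^ k`, which tends to `0`
(`fkgUpTo_poissonLaw`).

The intensity on `W*` may be infinite, but it is finite on each shell of trajectories that hit `K (n
+ 1)` and not `K n`. These shells partition `W*`. The process is built as the image of a countable
product of finite Poisson processes, one per shell, under a monotone superposition map
(`isPoissonPointProcess_superposition`). A countable product of laws satisfying FKG satisfies FKG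
(`satisfiesFKG_infinitePi`): the case of finitely many coordinates is an induction, and the general
case follows by approximating events by their conditional probabilities.

Being Poisson is checked throughout on joint characteristic functions of masses of disjoint sets.
The law is unique because the masses of finitely many arbitrary sets are sums of masses of disjoint
atoms (`IsPoissonPointProcess.map_eq`). The interlacement set and both families of counts are
monotone in the configuration, and the vacant set is antitone, so each inherits the inequality. -/

/-! ### Positive correlation with an additive error -/

section FKG

variable {α β : Type*} [MeasurableSpace α] [MeasurableSpace β]

/-- The FKG inequality up to an additive error `ε`, for bounded monotone functions. -/
def FKGUpTo [Preorder α] (P : Measure α) (ε : ℝ) : Prop :=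
  ∀ f g : α → ℝ, Measurable f → Measurable g → Monotone f → Monotone g →
    (∀ x, f x ∈ Set.Icc (0 : ℝ) 1) → (∀ x, g x ∈ Set.Icc (0 : ℝ) 1) →
    (∫ x, f x ∂P) * (∫ x, g x ∂P) ≤ (∫ x, f x * g x ∂P) + ε

theorem integrable_of_mem_unitInterval {P : Measure α} [IsFiniteMeasure P] {f : α → ℝ}
    (hf : Measurable f) (h : ∀ x, f x ∈ Set.Icc (0 : ℝ) 1) : Integrable f P :=
  Integrable.of_mem_Icc 0 1 hf.aemeasurable (ae_of_all _ h)

theorem mul_mem_unitInterval {a b : ℝ} (ha : a ∈ Set.Icc (0 : ℝ) 1) (hb : b ∈ Set.Icc (0 : ℝ) 1) :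
    a * b ∈ Set.Icc (0 : ℝ) 1 :=
  ⟨mul_nonneg ha.1 hb.1, mul_le_one₀ ha.2 hb.1 hb.2⟩

theorem integral_mem_unitInterval {P : Measure α} [IsProbabilityMeasure P] {f : α → ℝ}
    (hf : Measurable f) (h : ∀ x, f x ∈ Set.Icc (0 : ℝ) 1) :
    ∫ x, f x ∂P ∈ Set.Icc (0 : ℝ) 1 := by
  refine ⟨integral_nonneg fun x => (h x).1, ?_⟩
  calc ∫ x, f x ∂P ≤ ∫ _, (1 : ℝ) ∂P :=
        integral_mono (integrable_of_mem_unitInterval hf h) (integrable_const _) fun x => (h x).2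
    _ = 1 := by simp

variable [Preorder α] [Preorder β]

theorem FKGUpTo.mono {P : Measure α} {ε δ : ℝ} (h : FKGUpTo P ε) (hεδ : ε ≤ δ) : FKGUpTo P δ :=
  fun f g hf hg hfm hgm hf1 hg1 =>
    (h f g hf hg hfm hgm hf1 hg1).trans (by gcongr)

theorem FKGUpTo.map {P : Measure α} {ε : ℝ} (h : FKGUpTo P ε) {φ : α → β} (hφ : Measurable φ)
    (hφm : Monotone φ) : FKGUpTo (P.map φ) ε := by
  intro f g hf hg hfm hgm hf1 hg1
  have hfg : Measurable fun x => f x * g x := hf.mul hg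
  rw [integral_map hφ.aemeasurable hf.aestronglyMeasurable,
    integral_map hφ.aemeasurable hg.aestronglyMeasurable,
    integral_map hφ.aemeasurable hfg.aestronglyMeasurable]
  exact h _ _ (hf.comp hφ) (hg.comp hφ) (hfm.comp hφm) (hgm.comp hφm) (fun _ => hf1 _)
    (fun _ => hg1 _)

/-- Condition on the first coordinate. The inequality for `Q` on each slice costs `δ`; the slice
integrals are again monotone with values in [0,1], so the inequality for `P` applies to them and
costs `ε`. -/
theorem FKGUpTo.prod {P : Measure α} {Q : Measure β} [IsProbabilityMeasure P]
    [IsProbabilityMeasure Q] {ε δ : ℝ} (hP : FKGUpTo P ε) (hQ : FKGUpTo Q δ) :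
    FKGUpTo (P.prod Q) (ε + δ) := by
  intro f g hf hg hfm hgm hf1 hg1
  have hfg : Measurable fun x => f x * g x := hf.mul hg
  have hfg1 : ∀ x, f x * g x ∈ Set.Icc (0 : ℝ) 1 := fun x => mul_mem_unitInterval (hf1 x) (hg1 x)
  have key : ∀ {h : α × β → ℝ}, Measurable h → (∀ x, h x ∈ Set.Icc (0 : ℝ) 1) →
      Measurable (fun x => ∫ y, h (x, y) ∂Q) ∧
      (∀ x, ∫ y, h (x, y) ∂Q ∈ Set.Icc (0 : ℝ) 1) := fun hh h1 =>
    ⟨hh.stronglyMeasurable.integral_prod_right'.measurable,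
      fun x => integral_mem_unitInterval (hh.comp measurable_prodMk_left) fun _ => h1 _⟩
  have mono : ∀ {h : α × β → ℝ}, Measurable h → (∀ x, h x ∈ Set.Icc (0 : ℝ) 1) → Monotone h →
      Monotone (fun x => ∫ y, h (x, y) ∂Q) := fun hh h1 hm x x' hx =>
    integral_mono
      (integrable_of_mem_unitInterval (hh.comp measurable_prodMk_left) fun _ => h1 _)
      (integrable_of_mem_unitInterval (hh.comp measurable_prodMk_left) fun _ => h1 _)
      fun y => hm ⟨hx, le_rfl⟩
  rw [integral_prod _ (integrable_of_mem_unitInterval hf hf1),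
    integral_prod _ (integrable_of_mem_unitInterval hg hg1),
    integral_prod _ (integrable_of_mem_unitInterval hfg hfg1)]
  have h1 := hP _ _ (key hf hf1).1 (key hg hg1).1 (mono hf hf1 hfm) (mono hg hg1 hgm)
    (key hf hf1).2 (key hg hg1).2
  have h2 : ∫ x, (∫ y, f (x, y) ∂Q) * (∫ y, g (x, y) ∂Q) ∂P ≤
      ∫ x, ((∫ y, f (x, y) * g (x, y) ∂Q) + δ) ∂P := by
    refine integral_mono
      (integrable_of_mem_unitInterval ((key hf hf1).1.mul (key hg hg1).1)
        fun x => mul_mem_unitInterval ((key hf hf1).2 x) ((key hg hg1).2 x))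
      ((integrable_of_mem_unitInterval (key hfg hfg1).1 (key hfg hfg1).2).add
        (integrable_const _)) fun x => ?_
    exact hQ _ _ (hf.comp measurable_prodMk_left) (hg.comp measurable_prodMk_left)
      (fun y y' hy => hfm ⟨le_rfl, hy⟩) (fun y y' hy => hgm ⟨le_rfl, hy⟩) (fun _ => hf1 _)
      (fun _ => hg1 _)
  rw [integral_add (integrable_of_mem_unitInterval (key hfg hfg1).1
    (key hfg hfg1).2) (integrable_const _)] at h2
  simp only [integral_const, probReal_univ, one_smul] at h2
  linarith

/-- If a law puts mass at most `r` outside the set of minimal points, it satisfies the FKG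
inequality up to `r ^ 2`. -/
theorem fkgUpTo_of_real_le {P : Measure α} [IsProbabilityMeasure P] {a : α} (ha : ∀ x, a ≤ x)
    {S : Set α} (hS : MeasurableSet S) (hSa : ∀ x, x ∉ S → x ≤ a) {r : ℝ} (hr : P.real S ≤ r) :
    FKGUpTo P (r ^ 2) := by
  intro f g hf hg hfm hgm hf1 hg1
  have key : ∀ {h : α → ℝ}, Measurable h → Monotone h → (∀ x, h x ∈ Set.Icc (0 : ℝ) 1) →
      ∫ x, (h x - h a) ∂P ∈ Set.Icc 0 r := by
    intro h hh hm h1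
    refine ⟨integral_nonneg fun x => sub_nonneg.2 (hm (ha x)), le_trans ?_ hr⟩
    rw [← integral_indicator_one hS]
    refine integral_mono ((integrable_of_mem_unitInterval hh h1).sub (integrable_const _))
      ((integrable_const 1).indicator hS) fun x => ?_
    by_cases hx : x ∈ S
    · simp only [Set.indicator_of_mem hx, Pi.one_apply]
      linarith [(h1 x).2, (h1 a).1]
    · simp only [Set.indicator_of_notMem hx]
      linarith [hm (hSa x hx)]
  have hfi := integrable_of_mem_unitInterval (P := P) hf hf1
  have hgi := integrable_of_mem_unitInterval (P := P) hg hg1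
  have hfgi : Integrable (fun x => f x * g x) P := integrable_of_mem_unitInterval (hf.mul hg)
    fun x => mul_mem_unitInterval (hf1 x) (hg1 x)
  have hfi' : Integrable (fun x => f x * g a) P := hfi.mul_const _
  have hgi' : Integrable (fun x => f a * g x) P := hgi.const_mul _
  -- Both factors are nonnegative since `a` is least. Expanding shows that the covariance is at
  -- least minus the product of the means of `f - f a` and `g - g a`, and each of these means lies
  -- in `[0, r]`.
  have h0 : 0 ≤ ∫ x, (f x - f a) * (g x - g a) ∂P :=
    integral_nonneg fun x => mul_nonneg (sub_nonneg.2 (hfm (ha x))) (sub_nonneg.2 (hgm (ha x)))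
  have hexp : ∫ x, (f x - f a) * (g x - g a) ∂P =
      (∫ x, f x * g x ∂P) - (∫ x, f x ∂P) * g a - f a * (∫ x, g x ∂P) + f a * g a := by
    have : ∀ x, (f x - f a) * (g x - g a) = f x * g x - f x * g a - f a * g x + f a * g a :=
      fun x => by ring
    simp_rw [this]
    have h1 : Integrable (fun x => f x * g x - f x * g a) P := hfgi.sub hfi'
    have h2 : Integrable (fun x => f x * g x - f x * g a - f a * g x) P := h1.sub hgi'
    rw [integral_add h2 (integrable_const _), integral_sub h1 hgi', integral_sub hfgi hfi',
      integral_mul_const, integral_const_mul]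
    simp
  have hf2 := key hf hfm hf1
  have hg2 := key hg hgm hg1
  have hmul := mul_le_mul hf2.2 hg2.2 hg2.1 (hf2.1.trans hf2.2)
  rw [integral_sub hfi (integrable_const _), integral_sub hgi (integrable_const _)] at hmul
  simp only [integral_const, probReal_univ, one_smul] at hmul
  nlinarith

theorem fkgUpTo_zero_of_forall {P : Measure α} (h : ∀ ε > 0, FKGUpTo P ε) : FKGUpTo P 0 :=
  fun f g hf hg hfm hgm hf1 hg1 => by
    rw [add_zero]
    exact le_of_forall_pos_le_add fun ε hε => h ε hε f g hf hg hfm hgm hf1 hg1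

theorem SatisfiesFKG.map {P : Measure α} (h : SatisfiesFKG P) {φ : α → β} (hφ : Measurable φ)
    (hφm : Monotone φ) : SatisfiesFKG (P.map φ) := by
  intro A B hA hB hAu hBu
  rw [Measure.map_apply hφ hA, Measure.map_apply hφ hB, Measure.map_apply hφ (hA.inter hB)]
  exact h _ _ (hφ hA) (hφ hB) (hAu.preimage hφm) (hBu.preimage hφm)

/-- Preimages of increasing sets are decreasing, so their complements are increasing. Passing to the
complements of both events does not change their covariance. -/
theorem SatisfiesFKG.map_antitone {P : Measure α} [IsProbabilityMeasure P] (h : SatisfiesFKG P)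
    {φ : α → β} (hφ : Measurable φ) (hφm : Antitone φ) : SatisfiesFKG (P.map φ) := by
  intro A B hA hB hAu hBu
  rw [Measure.map_apply hφ hA, Measure.map_apply hφ hB, Measure.map_apply hφ (hA.inter hB),
    Set.preimage_inter]
  have hA' := hφ hA
  have hB' := hφ hB
  have up : ∀ {C : Set β}, IsUpperSet C → IsUpperSet (φ ⁻¹' C)ᶜ :=
    fun hC x y hxy hx hy => hx (hC (hφm hxy) hy)
  have key := h _ _ hA'.compl hB'.compl (up hAu) (up hBu)
  set A' := φ ⁻¹' A
  set B' := φ ⁻¹' B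
  rw [← Set.compl_union] at key
  have key' := ENNReal.toReal_mono (by finiteness) key
  rw [ENNReal.toReal_mul] at key'
  change P.real A'ᶜ * P.real B'ᶜ ≤ P.real (A' ∪ B')ᶜ at key'
  rw [probReal_compl_eq_one_sub hA', probReal_compl_eq_one_sub hB',
    probReal_compl_eq_one_sub (hA'.union hB')] at key'
  have hu := measureReal_union_add_inter (μ := P) (s := A') hB'
  rw [← ENNReal.toReal_le_toReal (by finiteness) (by finiteness), ENNReal.toReal_mul]
  change P.real A' * P.real B' ≤ P.real (A' ∩ B')
  nlinarith

end FKG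

/-! ### FKG for countable products -/

section InfiniteProduct

variable {α : ℕ → Type*} [∀ n, MeasurableSpace (α n)]

/-- The sequence that agrees with `x` before `n` and with `y` from `n` on. -/
def splice (n : ℕ) (p : (∀ k, α k) × (∀ k, α k)) : ∀ k, α k :=
  fun k => if k < n then p.1 k else p.2 k

theorem measurable_splice (n : ℕ) : Measurable (splice (α := α) n) := by
  refine measurable_pi_lambda _ fun k => ?_
  by_cases h : k < n <;> simp only [splice, h, if_true, if_false] <;> fun_prop

variable (Q : ∀ n, Measure (α n)) [∀ n, IsProbabilityMeasure (Q n)]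

/-- Splicing two independent copies gives another copy. Integrating out the second one is thus
conditional expectation given the coordinates below `n`. -/
theorem map_splice (n : ℕ) :
    ((Measure.infinitePi Q).prod (Measure.infinitePi Q)).map (splice n) =
      Measure.infinitePi Q := by
  refine Measure.eq_infinitePi _ fun s t ht => ?_
  have hpre : splice n ⁻¹' (Set.pi (s : Set ℕ) t) =
      (Set.pi ((s.filter (· < n) : Finset ℕ) : Set ℕ) t) ×ˢ
        (Set.pi ((s.filter (¬ · < n) : Finset ℕ) : Set ℕ) t) := by
    ext p
    simp only [Set.mem_preimage, Set.mem_pi, Set.mem_prod, splice, Finset.coe_filter,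
      Set.mem_ofPred_eq, Finset.mem_coe]
    constructor
    · intro h
      exact ⟨fun k hk => by simpa [hk.2] using h k hk.1, fun k hk => by simpa [hk.2] using h k hk.1⟩
    · rintro ⟨h1, h2⟩ k hk
      by_cases hkn : k < n
      · simpa [hkn] using h1 k ⟨hk, hkn⟩
      · simpa [hkn] using h2 k ⟨hk, hkn⟩
  rw [Measure.map_apply (measurable_splice n) (MeasurableSet.pi s.countable_toSet fun i _ => ht i),
    hpre, Measure.prod_prod, Measure.infinitePi_pi _ fun i _ => ht i,
    Measure.infinitePi_pi _ fun i _ => ht i, Finset.prod_filter_mul_prod_filter_not]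

theorem measurable_update_uncurry (n : ℕ) :
    Measurable (fun p : (∀ k, α k) × α n => Function.update p.1 n p.2) := by
  refine measurable_pi_lambda _ fun k => ?_
  rcases eq_or_ne k n with rfl | h
  · simpa using measurable_snd
  · simp only [Function.update_of_ne h]
    fun_prop

theorem map_update (n : ℕ) :
    ((Measure.infinitePi Q).prod (Q n)).map (fun p => Function.update p.1 n p.2) =
      Measure.infinitePi Q := by
  classical
  refine Measure.eq_infinitePi _ fun s t ht => ?_
  have hpre : (fun p : (∀ k, α k) × α n => Function.update p.1 n p.2) ⁻¹' (Set.pi (s : Set ℕ) t) =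
      (Set.pi ((s.erase n : Finset ℕ) : Set ℕ) t) ×ˢ (if n ∈ s then t n else Set.univ) := by
    ext p
    simp only [Set.mem_preimage, Set.mem_pi, Set.mem_prod, Finset.mem_coe, Finset.mem_erase]
    constructor
    · intro h
      refine ⟨fun k hk => by simpa [hk.1] using h k hk.2, ?_⟩
      split_ifs with hn
      · simpa using h n hn
      · trivial
    · rintro ⟨h1, h2⟩ k hk
      rcases eq_or_ne k n with rfl | hkn
      · simpa [hk] using h2
      · simpa [hkn] using h1 k ⟨hkn, hk⟩
  rw [Measure.map_apply (measurable_update_uncurry n)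
    (MeasurableSet.pi s.countable_toSet fun i _ => ht i), hpre, Measure.prod_prod,
    Measure.infinitePi_pi _ fun i _ => ht i]
  split_ifs with hn
  · exact Finset.prod_erase_mul s (fun i => Q i (t i)) hn
  · simp [hn]

/-- Induction on the number of relevant coordinates. Resampling coordinate `n` preserves the product
law (`map_update`). Integrating it out leaves monotone functions of the coordinates below `n`, and
FKG for `Q n` compares the product of the integrals with the integral of the product. -/
theorem fkg_of_dependsOn_lt [∀ n, Preorder (α n)] (hQ : ∀ n, FKGUpTo (Q n) 0) (n : ℕ) :
    ∀ f g : (∀ k, α k) → ℝ, Measurable f → Measurable g → Monotone f → Monotone g →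
      (∀ x, f x ∈ Set.Icc (0 : ℝ) 1) → (∀ x, g x ∈ Set.Icc (0 : ℝ) 1) →
      (∀ x y, (∀ k < n, x k = y k) → f x = f y) → (∀ x y, (∀ k < n, x k = y k) → g x = g y) →
      (∫ x, f x ∂Measure.infinitePi Q) * (∫ x, g x ∂Measure.infinitePi Q) ≤
        ∫ x, f x * g x ∂Measure.infinitePi Q := by
  induction n with
  | zero =>
    intro f g _ _ _ _ _ _ hfd hgd
    obtain ⟨a⟩ : Nonempty (∀ k, α k) := nonempty_of_isProbabilityMeasure (Measure.infinitePi Q)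
    simp_rw [fun x => hfd x a (by simp), fun x => hgd x a (by simp)]
    simp
  | succ n ih =>
    intro f g hf hg hfm hgm hf1 hg1 hfd hgd
    have hu := measurable_update_uncurry (α := α) n
    have hu' : ∀ x : ∀ k, α k, Measurable (Function.update x n) := fun x =>
      hu.comp measurable_prodMk_left
    have hum : ∀ x : ∀ k, α k, Monotone (Function.update x n) := fun x =>
      Function.update_mono
    have int : ∀ h : (∀ k, α k) → ℝ, Measurable h → (∀ x, h x ∈ Set.Icc (0 : ℝ) 1) →
        ∫ x, h x ∂Measure.infinitePi Q =
          ∫ x, ∫ y, h (Function.update x n y) ∂Q n ∂Measure.infinitePi Q := by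
      intro h hh h1
      conv_lhs => rw [← map_update Q n]
      have hi : Integrable (fun p : (∀ k, α k) × α n => h (Function.update p.1 n p.2))
          ((Measure.infinitePi Q).prod (Q n)) :=
        integrable_of_mem_unitInterval (hh.comp hu) fun _ => h1 _
      rw [integral_map hu.aemeasurable hh.aestronglyMeasurable, integral_prod _ hi]
    have meas : ∀ h : (∀ k, α k) → ℝ, Measurable h →
        Measurable (fun x => ∫ y, h (Function.update x n y) ∂Q n) := fun h hh =>
      (hh.comp hu).stronglyMeasurable.integral_prod_right'.measurable
    have mem : ∀ h : (∀ k, α k) → ℝ, Measurable h → (∀ x, h x ∈ Set.Icc (0 : ℝ) 1) →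
        ∀ x, ∫ y, h (Function.update x n y) ∂Q n ∈ Set.Icc (0 : ℝ) 1 := fun h hh h1 x =>
      integral_mem_unitInterval (hh.comp (hu' x)) fun _ => h1 _
    have mono : ∀ h : (∀ k, α k) → ℝ, Measurable h → (∀ x, h x ∈ Set.Icc (0 : ℝ) 1) →
        Monotone h → Monotone (fun x => ∫ y, h (Function.update x n y) ∂Q n) := by
      intro h hh h1 hm x x' hx
      refine integral_mono (integrable_of_mem_unitInterval (hh.comp (hu' x)) fun _ => h1 _)
        (integrable_of_mem_unitInterval (hh.comp (hu' x')) fun _ => h1 _) fun y => hm ?_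
      intro k
      rcases eq_or_ne k n with rfl | hkn
      · simp
      · simpa [hkn] using hx k
    have dep : ∀ h : (∀ k, α k) → ℝ, (∀ x y, (∀ k < n + 1, x k = y k) → h x = h y) →
        ∀ x y, (∀ k < n, x k = y k) → ∫ z, h (Function.update x n z) ∂Q n =
          ∫ z, h (Function.update y n z) ∂Q n := by
      intro h hd x y hxy
      refine integral_congr_ae (ae_of_all _ fun z => hd _ _ fun k hk => ?_)
      rcases eq_or_ne k n with rfl | hkn
      · simp
      · simpa [hkn] using hxy k (by omega)
    have hfg1 : ∀ x, f x * g x ∈ Set.Icc (0 : ℝ) 1 := fun x => mul_mem_unitInterval (hf1 x) (hg1 x)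
    rw [int f hf hf1, int g hg hg1, int (fun x => f x * g x) (hf.mul hg) hfg1]
    refine (ih _ _ (meas f hf) (meas g hg) (mono f hf hf1 hfm) (mono g hg hg1 hgm)
      (mem f hf hf1) (mem g hg hg1) (dep f hfd) (dep g hgd)).trans ?_
    refine integral_mono
      (integrable_of_mem_unitInterval ((meas f hf).mul (meas g hg))
        fun x => mul_mem_unitInterval (mem f hf hf1 x) (mem g hg hg1 x))
      (integrable_of_mem_unitInterval (meas _ (hf.mul hg)) (mem _ (hf.mul hg) hfg1)) fun x => ?_
    have := hQ n _ _ (hf.comp (hu' x)) (hg.comp (hu' x)) (hfm.comp (hum x)) (hgm.comp (hum x))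
      (fun _ => hf1 _) (fun _ => hg1 _)
    simpa using this

theorem integral_splice {f : (∀ k, α k) → ℝ} (hf : Measurable f)
    (hf1 : ∀ x, f x ∈ Set.Icc (0 : ℝ) 1) (n : ℕ) :
    ∫ x, ∫ y, f (splice n (x, y)) ∂Measure.infinitePi Q ∂Measure.infinitePi Q =
      ∫ x, f x ∂Measure.infinitePi Q := by
  have hi : Integrable (fun p => f (splice n p))
      ((Measure.infinitePi Q).prod (Measure.infinitePi Q)) :=
    integrable_of_mem_unitInterval (hf.comp (measurable_splice n)) fun _ => hf1 _
  rw [← integral_prod _ hi, ← integral_map (measurable_splice n).aemeasurable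
    hf.aestronglyMeasurable, map_splice]

theorem indicator_one_mem_unitInterval {β : Type*} (A : Set β) (x : β) :
    A.indicator (1 : β → ℝ) x ∈ Set.Icc (0 : ℝ) 1 := by
  by_cases h : x ∈ A <;> simp [h]

/-- Events of an infinite product are approximated by their conditional probabilities given finitely
many coordinates. -/
theorem exists_integral_abs_splice_le {A : Set (∀ k, α k)} (hA : MeasurableSet A) {ε : ℝ}
    (hε : 0 < ε) : ∃ n₀, ∀ n ≥ n₀,
      ∫ x, |(∫ y, A.indicator (1 : (∀ k, α k) → ℝ) (splice n (x, y)) ∂Measure.infinitePi Q) -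
        A.indicator (1 : (∀ k, α k) → ℝ) x| ∂Measure.infinitePi Q ≤ ε := by
  obtain ⟨A', hA', hAA'⟩ := (Measure.MeasureDense.of_generateFrom_isSetAlgebra_finite
    (Measure.infinitePi Q) (𝒜 := measurableCylinders α)
    ⟨empty_mem_measurableCylinders α, fun _ hs => compl_mem_measurableCylinders hs,
      fun _ _ hs ht => union_mem_measurableCylinders hs ht⟩
    generateFrom_measurableCylinders.symm).approx A hA (measure_ne_top _ _) (ε / 2) (by positivity)
  have hA'm := MeasurableSet.of_mem_measurableCylinders hA'
  obtain ⟨s, S, -, rfl⟩ := (mem_measurableCylinders _).1 hA'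
  -- For such `n` every index of the cylinder is below `n`, so splicing does not affect membership
  -- in it.
  refine ⟨s.sup id + 1, fun n hn => ?_⟩
  set A' := cylinder s S
  set P := Measure.infinitePi Q
  set a := A.indicator (1 : (∀ k, α k) → ℝ)
  set b := A'.indicator (1 : (∀ k, α k) → ℝ)
  have ha : Measurable a := measurable_one.indicator hA
  have hb : Measurable b := measurable_one.indicator hA'm
  have hbs : ∀ x y, b (splice n (x, y)) = b x := by
    intro x y
    have : s.restrict (splice n (x, y)) = s.restrict x := by
      ext ⟨k, hk⟩
      have : k < n := by
        have := Finset.le_sup (f := id) hk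
        simp only [id] at this
        omega
      simp [splice, this]
    have hmem : splice n (x, y) ∈ A' ↔ x ∈ A' := by
      simp only [A', mem_cylinder, this]
    by_cases h : x ∈ A' <;> simp [b, hmem, h]
  set D : (∀ k, α k) → ℝ := fun x => |a x - b x|
  have hD : Measurable D := (ha.sub hb).abs
  have hD1 : ∀ x, D x ∈ Set.Icc (0 : ℝ) 1 := fun x => by
    have h1 := indicator_one_mem_unitInterval A x
    have h2 := indicator_one_mem_unitInterval A' x
    refine ⟨abs_nonneg _, abs_le.2 ⟨?_, ?_⟩⟩ <;> simp only [a, b] <;>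
      linarith [h1.1, h1.2, h2.1, h2.2]
  have hDint : ∫ x, D x ∂P ≤ ε / 2 := by
    have : D = (symmDiff A A').indicator 1 := by
      ext x
      by_cases h1 : x ∈ A <;> by_cases h2 : x ∈ A' <;>
        simp [D, a, b, h1, h2, Set.mem_symmDiff, Set.indicator]
    rw [this, integral_indicator_one (hA.symmDiff hA'm)]
    exact ENNReal.toReal_le_of_le_ofReal (by positivity) hAA'.le
  have hsp : ∀ x, Measurable fun y => splice (α := α) n (x, y) := fun x =>
    (measurable_splice n).comp measurable_prodMk_left
  have hai : ∀ x, Integrable (fun y => a (splice n (x, y))) P := fun x =>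
    integrable_of_mem_unitInterval (ha.comp (hsp x)) fun _ => indicator_one_mem_unitInterval _ _
  -- Conditioning fixes `b`, so the triangle inequality through `b` applies. Both terms on the right
  -- have the same mean, the measure of the symmetric difference of `A` and `A'`, which is at most
  -- `ε / 2`.
  have hpt : ∀ x, |(∫ y, a (splice n (x, y)) ∂P) - a x| ≤ (∫ y, D (splice n (x, y)) ∂P) + D x := by
    intro x
    have h1 : (∫ y, a (splice n (x, y)) ∂P) - a x =
        (∫ y, (a (splice n (x, y)) - b (splice n (x, y))) ∂P) + (b x - a x) := by
      simp_rw [hbs]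
      rw [integral_sub (hai x) (integrable_const _)]
      simp
    rw [h1]
    refine (abs_add_le _ _).trans (add_le_add abs_integral_le_integral_abs ?_)
    rw [abs_sub_comm]
  have hD2 : Measurable fun x => ∫ y, D (splice n (x, y)) ∂P :=
    (hD.comp (measurable_splice n)).stronglyMeasurable.integral_prod_right'.measurable
  have hD2i : Integrable (fun x => ∫ y, D (splice n (x, y)) ∂P) P :=
    integrable_of_mem_unitInterval hD2
      fun x => integral_mem_unitInterval (hD.comp (hsp x)) fun _ => hD1 _
  have hDi : Integrable D P := integrable_of_mem_unitInterval hD hD1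
  calc ∫ x, |(∫ y, a (splice n (x, y)) ∂P) - a x| ∂P
      ≤ ∫ x, ((∫ y, D (splice n (x, y)) ∂P) + D x) ∂P :=
        integral_mono_of_nonneg (ae_of_all _ fun _ => abs_nonneg _) (hD2i.add hDi) (ae_of_all _ hpt)
    _ = (∫ x, D x ∂P) + ∫ x, D x ∂P := by
        rw [integral_add hD2i hDi, integral_splice Q hD hD1]
    _ ≤ ε := by linarith

/-- A countable product of laws satisfying the FKG inequality satisfies the FKG inequality. -/
theorem satisfiesFKG_infinitePi [∀ n, Preorder (α n)] (hQ : ∀ n, FKGUpTo (Q n) 0) :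
    SatisfiesFKG (Measure.infinitePi Q) := by
  intro A B hA hB hAu hBu
  set P := Measure.infinitePi Q
  rw [← ENNReal.toReal_le_toReal (by finiteness) (by finiteness), ENNReal.toReal_mul]
  change P.real A * P.real B ≤ P.real (A ∩ B)
  refine le_of_forall_pos_le_add fun ε hε => ?_
  obtain ⟨n₁, h₁⟩ := exists_integral_abs_splice_le Q hA (half_pos hε)
  obtain ⟨n₂, h₂⟩ := exists_integral_abs_splice_le Q hB (half_pos hε)
  set n := max n₁ n₂
  replace h₁ := h₁ n (le_max_left _ _)
  replace h₂ := h₂ n (le_max_right _ _)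
  have hsp : ∀ x, Measurable fun y => splice (α := α) n (x, y) := fun x =>
    (measurable_splice n).comp measurable_prodMk_left
  -- `F C` is the conditional probability of `C` given the coordinates below `n`. It is monotone for
  -- increasing `C` and has mean `P.real C`.
  let F : Set (∀ k, α k) → (∀ k, α k) → ℝ := fun C x =>
    ∫ y, C.indicator (1 : (∀ k, α k) → ℝ) (splice n (x, y)) ∂P
  have ind : ∀ {C : Set (∀ k, α k)}, MeasurableSet C →
      Measurable (C.indicator (1 : (∀ k, α k) → ℝ)) := fun hC => measurable_one.indicator hC
  have meas : ∀ {C : Set (∀ k, α k)}, MeasurableSet C → Measurable (F C) := fun hC =>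
    ((ind hC).comp (measurable_splice n)).stronglyMeasurable.integral_prod_right'.measurable
  have mem : ∀ {C : Set (∀ k, α k)}, MeasurableSet C → ∀ x, F C x ∈ Set.Icc (0 : ℝ) 1 :=
    fun hC x => integral_mem_unitInterval ((ind hC).comp (hsp x))
      fun _ => indicator_one_mem_unitInterval _ _
  have mono : ∀ {C : Set (∀ k, α k)}, MeasurableSet C → IsUpperSet C → Monotone (F C) := by
    intro C hC hCu x x' hx
    refine integral_mono
      (integrable_of_mem_unitInterval ((ind hC).comp (hsp x))
        fun _ => indicator_one_mem_unitInterval _ _)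
      (integrable_of_mem_unitInterval ((ind hC).comp (hsp x'))
        fun _ => indicator_one_mem_unitInterval _ _) fun y => ?_
    have hle : splice (α := α) n (x, y) ≤ splice n (x', y) := by
      intro k
      by_cases h : k < n
      · simpa [splice, h] using hx k
      · simp [splice, h]
    by_cases h : splice (α := α) n (x, y) ∈ C
    · simp [h, hCu hle h]
    · simpa [h] using (indicator_one_mem_unitInterval C (splice n (x', y))).1
  have dep : ∀ C : Set (∀ k, α k), ∀ x y, (∀ k < n, x k = y k) → F C x = F C y := by
    intro C x y hxy
    have : ∀ z, splice (α := α) n (x, z) = splice n (y, z) := by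
      intro z
      ext k
      by_cases h : k < n
      · simp [splice, h, hxy k h]
      · simp [splice, h]
    simp only [F, this]
  have tot : ∀ {C : Set (∀ k, α k)}, MeasurableSet C → ∫ x, F C x ∂P = P.real C := fun hC => by
    rw [← integral_indicator_one hC]
    exact integral_splice Q (ind hC) (indicator_one_mem_unitInterval _) n
  have key := fkg_of_dependsOn_lt Q hQ n (F A) (F B) (meas hA) (meas hB) (mono hA hAu)
    (mono hB hBu) (mem hA) (mem hB) (dep A) (dep B)
  rw [tot hA, tot hB] at key
  refine key.trans ?_
  set a := A.indicator (1 : (∀ k, α k) → ℝ)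
  set b := B.indicator (1 : (∀ k, α k) → ℝ)
  have iabs : ∀ {C : Set (∀ k, α k)}, MeasurableSet C →
      Integrable (fun x => |F C x - C.indicator (1 : (∀ k, α k) → ℝ) x|) P := fun hC =>
    ((integrable_of_mem_unitInterval (meas hC) (mem hC)).sub
      (integrable_of_mem_unitInterval (ind hC) (indicator_one_mem_unitInterval _))).abs
  have iab : Integrable ((A ∩ B).indicator (1 : (∀ k, α k) → ℝ)) P :=
    integrable_of_mem_unitInterval (ind (hA.inter hB)) (indicator_one_mem_unitInterval _)
  -- Pointwise, `F A * F B - a * b = F A * (F B - b) + b * (F A - a)`, and both multipliers lie in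
  -- [0,1].
  calc ∫ x, F A x * F B x ∂P
      ≤ ∫ x, (|F A x - a x| + |F B x - b x| + (A ∩ B).indicator (1 : (∀ k, α k) → ℝ) x) ∂P := by
        refine integral_mono
          (integrable_of_mem_unitInterval ((meas hA).mul (meas hB))
            fun x => mul_mem_unitInterval (mem hA x) (mem hB x))
          (((iabs hA).add (iabs hB)).add iab) fun x => ?_
        have hx : (A ∩ B).indicator (1 : (∀ k, α k) → ℝ) x = a x * b x := by
          rw [Set.inter_indicator_one, Pi.mul_apply]
        simp only [hx]
        have ha := indicator_one_mem_unitInterval A x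
        have hb := indicator_one_mem_unitInterval B x
        have h1 := mul_le_mul_of_nonneg_left (le_abs_self (F B x - b x)) (mem hA x).1
        have h2 := mul_le_of_le_one_left (abs_nonneg (F B x - b x)) (mem hA x).2
        have h3 := mul_le_mul_of_nonneg_left (le_abs_self (F A x - a x)) hb.1
        have h4 := mul_le_of_le_one_left (abs_nonneg (F A x - a x)) hb.2
        simp only [a, b] at *
        nlinarith
    _ = (∫ x, |F A x - a x| ∂P) + (∫ x, |F B x - b x| ∂P) + P.real (A ∩ B) := by
        have iAB : Integrable (fun x => |F A x - a x| + |F B x - b x|) P := (iabs hA).add (iabs hB)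
        rw [integral_add iAB iab, integral_add (iabs hA) (iabs hB),
          integral_indicator_one (hA.inter hB)]
    _ ≤ P.real (A ∩ B) + ε := by linarith

end InfiniteProduct

/-! ### Recognising Poisson processes by characteristic functions -/

section PoissonCriterion

open Complex

variable {Ω X : Type*} [MeasurableSpace Ω] [MeasurableSpace X]

/-- The joint characteristic function of the masses of the sets `D i`, under the random measure
`ξ`. -/
noncomputable def massCharFun (ξ : Ω → Measure X) (P : Measure Ω) {m : ℕ} (D : Fin m → Set X)
    (t : Fin m → ℝ) : ℂ :=
  ∫ ω, cexp (((∑ i, t i * (ξ ω (D i)).toReal : ℝ) : ℂ) * I) ∂P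

/-- A random measure is a Poisson point process as soon as the masses of finitely many disjoint sets
of finite intensity have the right joint characteristic function. -/
theorem isPoissonPointProcess_of_massCharFun {ν : Measure X} {ξ : Ω → Measure X} {P : Measure Ω}
    [IsProbabilityMeasure P] (hξ : Measurable ξ)
    (hfin : ∀ D, MeasurableSet D → ν D ≠ ∞ → ∀ᵐ ω ∂P, ξ ω D ≠ ∞)
    (htop : ∀ D, MeasurableSet D → ν D = ∞ → ∀ᵐ ω ∂P, ξ ω D = ∞)
    (hchar : ∀ (m : ℕ) (D : Fin m → Set X) (t : Fin m → ℝ), (∀ i, MeasurableSet (D i)) →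
      Pairwise (fun i j => Disjoint (D i) (D j)) → (∀ i, ν (D i) ≠ ∞) →
      massCharFun ξ P D t = cexp (∑ i, ((ν (D i)).toReal : ℂ) * (cexp (t i * I) - 1))) :
    IsPoissonPointProcess ν ξ P := by
  have hmeas : ∀ {D : Set X}, MeasurableSet D → Measurable fun ω => ξ ω D := fun hD =>
    (Measure.measurable_coe hD).comp hξ
  have hmeas' : ∀ {D : Set X}, MeasurableSet D → Measurable fun ω => (ξ ω D).toReal := fun hD =>
    (hmeas hD).ennreal_toReal
  -- Characteristic functions concern the real masses `(ξ ω D).toReal`. On sets of finite intensity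
  -- nothing is lost, almost surely.
  have hofReal : ∀ {D : Set X}, MeasurableSet D → ν D ≠ ∞ →
      (fun ω => ENNReal.ofReal (ξ ω D).toReal) =ᵐ[P] fun ω => ξ ω D := fun hD hνD => by
    filter_upwards [hfin _ hD hνD] with ω hω using ENNReal.ofReal_toReal hω
  have hsingle : ∀ {D : Set X}, MeasurableSet D → ν D ≠ ∞ → ∀ t : ℝ,
      charFun (P.map fun ω => (ξ ω D).toReal) t =
        cexp (((ν D).toReal : ℂ) * (cexp (t * I) - 1)) := by
    intro D hD hνD t
    have := hchar 1 (fun _ => D) (fun _ => t) (fun _ => hD)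
      (fun i j hij => (hij (Subsingleton.elim i j)).elim) (fun _ => hνD)
    simp only [massCharFun, Finset.univ_unique, Finset.sum_const, Finset.card_singleton,
      one_smul] at this
    rw [charFun_apply_real, integral_map (hmeas' hD).aemeasurable (by fun_prop), ← this]
    simp
  have hpoisson : ∀ {D : Set X}, MeasurableSet D → ν D ≠ ∞ →
      P.map (fun ω => (ξ ω D).toReal) =
        (poissonMeasure (ν D).toNNReal).map (Nat.cast : ℕ → ℝ) := by
    intro D hD hνD
    have := Measure.isProbabilityMeasure_map (μ := P) (hmeas' hD).aemeasurable
    have := Measure.isProbabilityMeasure_map (μ := poissonMeasure (ν D).toNNReal)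
      (f := (Nat.cast : ℕ → ℝ)) (by fun_prop)
    refine Measure.ext_of_charFun ?_
    ext t
    rw [hsingle hD hνD, charFun_map_cast_poissonMeasure]
    rfl
  have hindep : ∀ (m : ℕ) (D : Fin m → Set X), (∀ i, MeasurableSet (D i)) →
      Pairwise (fun i j => Disjoint (D i) (D j)) → (∀ i, ν (D i) ≠ ∞) →
      iIndepFun (fun i ω => ξ ω (D i)) P := by
    intro m D hD hdisj hνD
    have key : iIndepFun (fun i ω => (ξ ω (D i)).toReal) P := by
      rw [iIndepFun_iff_charFun_pi fun i => (hmeas' (hD i)).aemeasurable]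
      intro t
      simp_rw [fun i => hsingle (hD i) (hνD i)]
      have hm : Measurable fun ω => WithLp.toLp 2 fun i => (ξ ω (D i)).toReal :=
        (WithLp.measurable_toLp 2 _).comp (measurable_pi_lambda _ fun i => hmeas' (hD i))
      rw [← Complex.exp_sum, ← hchar m D t.ofLp hD hdisj hνD, massCharFun, charFun_apply,
        integral_map hm.aemeasurable (by fun_prop)]
      simp [PiLp.inner_apply]
    refine iIndepFun.congr (fun i => hofReal (hD i) (hνD i)) ?_
    exact key.comp (fun _ => ENNReal.ofReal) fun _ => ENNReal.measurable_ofReal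
  refine ⟨inferInstance, hξ, fun D hD hνD => ?_, htop, fun m D hD hdisj => ?_⟩
  · rw [← Measure.map_congr (hofReal hD hνD)]
    have h1 := congrArg (Measure.map ENNReal.ofReal) (hpoisson hD hνD)
    rw [Measure.map_map ENNReal.measurable_ofReal (hmeas' hD),
      Measure.map_map ENNReal.measurable_ofReal (by fun_prop)] at h1
    simpa [Function.comp_def] using h1
  · classical
    -- Masses of sets of infinite intensity are almost surely the constant `∞`. Such sets are
    -- replaced by `∅`, and the constant is put back by a deterministic map applied to each
    -- coordinate.
    have h1 := hindep m (fun i => if ν (D i) = ∞ then ∅ else D i)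
      (fun i => by split_ifs; exacts [MeasurableSet.empty, hD i])
      (fun i j hij => by dsimp only; split_ifs <;> simp [hdisj hij])
      (fun i => by split_ifs with h <;> simp [h])
    have h2 := h1.comp (fun i x => if ν (D i) = ∞ then ∞ else x)
      (fun i => by split_ifs <;> fun_prop)
    refine iIndepFun.congr (fun i => ?_) h2
    by_cases h : ν (D i) = ∞
    · filter_upwards [htop _ (hD i) h] with ω hω
      simp [h, hω]
    · simp only [h, if_false]
      exact Filter.EventuallyEq.rfl

end PoissonCriterion

/-! ### Uniqueness in law -/

section PoissonUniqueness

variable {Ω Ω' X : Type*} [MeasurableSpace Ω] [MeasurableSpace Ω'] [MeasurableSpace X]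
  {ν : Measure X} {ξ : Ω → Measure X} {ξ' : Ω' → Measure X} {P : Measure Ω} {P' : Measure Ω'}

theorem IsPoissonPointProcess.map_apply_eq (h : IsPoissonPointProcess ν ξ P)
    (h' : IsPoissonPointProcess ν ξ' P') {D : Set X} (hD : MeasurableSet D) :
    P.map (fun ω => ξ ω D) = P'.map (fun ω => ξ' ω D) := by
  by_cases hν : ν D = ∞
  · have := h.isProbabilityMeasure
    have := h'.isProbabilityMeasure
    rw [Measure.map_congr (g := fun _ => ∞) (h.ae_apply_eq_top D hD hν),
      Measure.map_congr (g := fun _ => ∞) (h'.ae_apply_eq_top D hD hν)]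
    simp [Measure.map_const]
  · rw [h.map_apply_eq_poisson D hD hν, h'.map_apply_eq_poisson D hD hν]

theorem IsPoissonPointProcess.iIndepFun_fintype (h : IsPoissonPointProcess ν ξ P) {ι : Type*}
    [Fintype ι] {D : ι → Set X} (hD : ∀ i, MeasurableSet (D i))
    (hdisj : Pairwise (fun i j => Disjoint (D i) (D j))) : iIndepFun (fun i ω => ξ ω (D i)) P := by
  let e := Fintype.equivFin ι
  have h1 := (h.iIndepFun_apply _ (fun i => D (e.symm i)) (fun i => hD _)
    (fun i j hij => hdisj (e.symm.injective.ne hij))).precomp e.injective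
  simpa [Function.comp_def] using h1

theorem IsPoissonPointProcess.map_vector_eq (h : IsPoissonPointProcess ν ξ P)
    (h' : IsPoissonPointProcess ν ξ' P') {ι : Type*} [Fintype ι] {D : ι → Set X}
    (hD : ∀ i, MeasurableSet (D i)) (hdisj : Pairwise (fun i j => Disjoint (D i) (D j))) :
    P.map (fun ω i => ξ ω (D i)) = P'.map (fun ω i => ξ' ω (D i)) := by
  have := h.isProbabilityMeasure
  have := h'.isProbabilityMeasure
  have hm : ∀ i, AEMeasurable (fun ω => ξ ω (D i)) P := fun i =>
    ((Measure.measurable_coe (hD i)).comp h.measurable).aemeasurable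
  have hm' : ∀ i, AEMeasurable (fun ω => ξ' ω (D i)) P' := fun i =>
    ((Measure.measurable_coe (hD i)).comp h'.measurable).aemeasurable
  rw [(iIndepFun_iff_map_fun_eq_pi_map hm).1 (h.iIndepFun_fintype hD hdisj),
    (iIndepFun_iff_map_fun_eq_pi_map hm').1 (h'.iIndepFun_fintype hD hdisj)]
  congr 1
  ext1 i
  exact h.map_apply_eq h' (hD i)

/-- The atom of the partition generated by the sets `s ∈ p` that consists of the points lying in
exactly the sets of `T`. -/
def partitionAtom {X : Type*} (p T : Finset (Set X)) : Set X := {x | ∀ s ∈ p, x ∈ s ↔ s ∈ T}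

theorem measurableSet_partitionAtom {p T : Finset (Set X)} (hp : ∀ s ∈ p, MeasurableSet s) :
    MeasurableSet (partitionAtom p T) := by
  classical
  have : partitionAtom p T = ⋂ s ∈ p, if s ∈ T then s else sᶜ := by
    ext x
    simp only [partitionAtom, Set.mem_ofPred_eq, Set.mem_iInter]
    refine forall₂_congr fun s _ => ?_
    split_ifs with h <;> simp [h]
  rw [this]
  refine p.measurableSet_biInter fun s hs => ?_
  split_ifs
  exacts [hp s hs, (hp s hs).compl]

theorem disjoint_partitionAtom {X : Type*} {p T T' : Finset (Set X)} (hT : T ⊆ p) (hT' : T' ⊆ p)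
    (hne : T ≠ T') : Disjoint (partitionAtom p T) (partitionAtom p T') := by
  refine Set.disjoint_left.2 fun x hx hx' => hne ?_
  ext s
  constructor
  · exact fun hs => (hx' s (hT hs)).1 ((hx s (hT hs)).2 hs)
  · exact fun hs => (hx s (hT' hs)).1 ((hx' s (hT' hs)).2 hs)

open Classical in
theorem measure_eq_sum_partitionAtom (μ : Measure X) {p : Finset (Set X)}
    (hp : ∀ s ∈ p, MeasurableSet s) {s : Set X} (hs : s ∈ p) :
    μ s = ∑ T ∈ p.powerset with s ∈ T, μ (partitionAtom p T) := by
  have hU : s = ⋃ T ∈ p.powerset.filter (s ∈ ·), partitionAtom p T := by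
    ext x
    simp only [Set.mem_iUnion, Finset.mem_filter, Finset.mem_powerset, exists_prop]
    constructor
    · intro hx
      exact ⟨p.filter (x ∈ ·), ⟨Finset.filter_subset _ _, by simp [hs, hx]⟩,
        fun s' hs' => by simp [hs']⟩
    · rintro ⟨T, ⟨-, hsT⟩, hx⟩
      exact (hx s hs).2 hsT
  conv_lhs => rw [hU]
  refine measure_biUnion_finset (fun T hT T' hT' hne => ?_) fun T _ =>
    measurableSet_partitionAtom hp
  simp only [Finset.coe_filter, Finset.mem_powerset, Set.mem_ofPred_eq] at hT hT'
  exact disjoint_partitionAtom hT.1 hT'.1 hne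

/-- The law of a Poisson point process is determined by its intensity measure. -/
theorem IsPoissonPointProcess.map_eq (h : IsPoissonPointProcess ν ξ P)
    (h' : IsPoissonPointProcess ν ξ' P') : P.map ξ = P'.map ξ' := by
  classical
  have := h.isProbabilityMeasure
  have := h'.isProbabilityMeasure
  have := Measure.isProbabilityMeasure_map (μ := P) h.measurable.aemeasurable
  have := Measure.isProbabilityMeasure_map (μ := P') h'.measurable.aemeasurable
  -- The `σ`-algebra on measures is the supremum of those generated by single evaluations. Finite
  -- intersections of events from these form a generating π-system, on which it suffices to compare
  -- the laws.
  let mS : {s : Set X // MeasurableSet s} → MeasurableSpace (Measure X) :=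
    fun s => (borel ℝ≥0∞).comap fun μ => μ s.1
  have hgen : (Measure.instMeasurableSpace : MeasurableSpace (Measure X)) =
      MeasurableSpace.generateFrom
        (piiUnionInter (fun s => {A | MeasurableSet[mS s] A}) Set.univ) := by
    refine Eq.trans ?_ (generateFrom_piiUnionInter_measurableSet mS Set.univ).symm
    simp only [Set.mem_univ, iSup_pos, mS, iSup_subtype]
    rfl
  refine ext_of_generate_finite _ hgen
    (isPiSystem_piiUnionInter _ (fun s => @MeasurableSpace.isPiSystem_measurableSet _ (mS s)) _)
    ?_ (by simp)
  rintro _ ⟨t, -, f, hf, rfl⟩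
  choose! A hA hAf using fun x hx => (hf x hx : ∃ A, _)
  replace hA : ∀ x ∈ t, MeasurableSet (A x) := fun x hx => by
    have := hA x hx
    rwa [← BorelSpace.measurable_eq] at this
  let p : Finset (Set X) := t.image Subtype.val
  have hp : ∀ s ∈ p, MeasurableSet s := by
    intro s hs
    obtain ⟨x, -, rfl⟩ := Finset.mem_image.1 hs
    exact x.2
  let D : p.powerset → Set X := fun T => partitionAtom p T.1
  have hD : ∀ T, MeasurableSet (D T) := fun T => measurableSet_partitionAtom hp
  have hdisj : Pairwise (fun T T' => Disjoint (D T) (D T')) := fun T T' hne =>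
    disjoint_partitionAtom (Finset.mem_powerset.1 T.2) (Finset.mem_powerset.1 T'.2)
      (Subtype.coe_injective.ne hne)
  -- The sets in `t` may overlap, so their masses are written as sums over the atoms they generate;
  -- the law of the vector of atom masses is already determined.
  let S : Set (p.powerset → ℝ≥0∞) :=
    ⋂ x ∈ t, {v | ∑ T : p.powerset with x.1 ∈ T.1, v T ∈ A x}
  have hS : MeasurableSet S := by
    refine t.measurableSet_biInter fun x hx => ?_
    exact (hA x hx).preimage (by fun_prop)
  have hpre : (⋂ x ∈ t, f x) = (fun μ : Measure X => fun T => μ (D T)) ⁻¹' S := by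
    ext μ
    simp only [S, Set.mem_iInter, Set.mem_preimage, Set.mem_ofPred_eq]
    refine forall₂_congr fun x hx => ?_
    rw [← hAf x hx, Set.mem_preimage,
      measure_eq_sum_partitionAtom μ hp (Finset.mem_image_of_mem _ hx)]
    have hsum : ∑ T ∈ p.powerset with x.1 ∈ T, μ (partitionAtom p T) =
        ∑ T : p.powerset with x.1 ∈ T.1, μ (D T) := by
      rw [Finset.sum_filter, Finset.sum_filter, ← Finset.sum_coe_sort]
    rw [hsum]
  have hmeas : Measurable fun μ : Measure X => fun T => μ (D T) :=
    measurable_pi_lambda _ fun T => Measure.measurable_coe (hD T)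
  rw [hpre, ← Measure.map_apply hmeas hS, ← Measure.map_apply hmeas hS,
    Measure.map_map hmeas h.measurable, Measure.map_map hmeas h'.measurable]
  exact congrArg (· S) (h.map_vector_eq h' hD hdisj)

end PoissonUniqueness

/-! ### Poisson processes of finite intensity -/

section FinitePoisson

open Complex

variable {X : Type*} [MeasurableSpace X]

/-- Finite sums of Dirac masses. -/
def finitePointMeasures (X : Type*) [MeasurableSpace X] : AddSubmonoid (Measure X) :=
  AddSubmonoid.closure (Set.range Measure.dirac)

instance (ξ : finitePointMeasures X) : IsFiniteMeasure ξ.1 := by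
  refine AddSubmonoid.closure_induction (motive := fun μ _ => IsFiniteMeasure μ) ?_ ?_ ?_ ξ.2
  · rintro _ ⟨x, rfl⟩
    infer_instance
  · infer_instance
  · intro μ μ' _ _ _ _
    infer_instance

/-- The sum of the Dirac masses at finitely many points. -/
noncomputable def sumDirac {k : ℕ} (x : Fin k → X) : finitePointMeasures X :=
  ⟨∑ i, Measure.dirac (x i), AddSubmonoid.sum_mem _ fun i _ =>
    AddSubmonoid.subset_closure ⟨x i, rfl⟩⟩

theorem measurable_sumDirac (k : ℕ) : Measurable (sumDirac (X := X) (k := k)) := by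
  refine Measurable.subtype_mk ?_
  exact Finset.measurable_fun_sum _ fun i _ => Measure.measurable_dirac.comp (measurable_pi_apply i)

theorem toReal_sumDirac_apply {k : ℕ} (x : Fin k → X) {D : Set X} (hD : MeasurableSet D) :
    ((sumDirac x).1 D).toReal = ∑ i, D.indicator (1 : X → ℝ) (x i) := by
  simp only [sumDirac, Measure.coe_finsetSum, Finset.sum_apply, Measure.dirac_apply' _ hD]
  rw [ENNReal.toReal_sum fun i _ => by by_cases h : x i ∈ D <;> simp [h]]
  refine Finset.sum_congr rfl fun i _ => ?_
  by_cases h : x i ∈ D <;> simp [h]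

/-- The law of the Poisson point process with finite intensity measure `ν`. -/
noncomputable def poissonLaw (ν : Measure X) : Measure (finitePointMeasures X) :=
  Measure.sum fun k : ℕ => ENNReal.ofReal (Real.exp (-(ν Set.univ).toReal) / k.factorial) •
    (Measure.pi fun _ : Fin k => ν).map sumDirac

variable (ν : Measure X) [IsFiniteMeasure ν]

/-- The product measure of `k` copies of `ν` is not normalised and has mass `ν(X) ^ k`, so the
`k`-th summand carries exactly the Poisson weight. The case `ν = 0` needs no separate treatment. -/
instance : IsProbabilityMeasure (poissonLaw ν) := by
  refine ⟨?_⟩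
  rw [poissonLaw, Measure.sum_apply _ MeasurableSet.univ]
  have : ∀ k : ℕ, (ENNReal.ofReal (Real.exp (-(ν Set.univ).toReal) / k.factorial) •
      (Measure.pi fun _ : Fin k => ν).map sumDirac) Set.univ =
      ENNReal.ofReal (Real.exp (-(ν Set.univ).toNNReal) * (ν Set.univ).toNNReal ^ k /
        k.factorial) := by
    intro k
    rw [Measure.smul_apply, Measure.map_apply (measurable_sumDirac k) MeasurableSet.univ,
      Set.preimage_univ, Measure.pi_univ, smul_eq_mul, Finset.prod_const, Finset.card_univ,
      Fintype.card_fin, ← ENNReal.ofReal_toReal (measure_ne_top ν Set.univ),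
      ← ENNReal.ofReal_pow ENNReal.toReal_nonneg, ← ENNReal.ofReal_mul (by positivity)]
    congr 1
    simp only [ENNReal.ofReal_toReal (measure_ne_top ν Set.univ), ENNReal.coe_toNNReal_eq_toReal]
    ring
  simp_rw [this]
  rw [← ENNReal.ofReal_tsum_of_nonneg (fun n => by positivity)
    (hasSum_one_poissonMeasure _).summable, (hasSum_one_poissonMeasure _).tsum_eq,
    ENNReal.ofReal_one]

theorem hasSum_integral_poissonLaw {h : finitePointMeasures X → ℂ} (hh : Measurable h)
    (hb : ∀ ξ, ‖h ξ‖ ≤ 1) :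
    HasSum (fun k : ℕ => ((Real.exp (-(ν Set.univ).toReal) / k.factorial : ℝ) : ℂ) *
      ∫ x, h (sumDirac x) ∂Measure.pi fun _ : Fin k => ν) (∫ ξ, h ξ ∂poissonLaw ν) := by
  have hi : Integrable h (poissonLaw ν) :=
    Integrable.of_bound hh.aestronglyMeasurable 1 (ae_of_all _ hb)
  have hs := hasSum_integral_measure hi
  have hk : ∀ k : ℕ, ∫ ξ, h ξ ∂(ENNReal.ofReal (Real.exp (-(ν Set.univ).toReal) / k.factorial) •
      (Measure.pi fun _ : Fin k => ν).map sumDirac) =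
      ((Real.exp (-(ν Set.univ).toReal) / k.factorial : ℝ) : ℂ) *
        ∫ x, h (sumDirac x) ∂Measure.pi fun _ : Fin k => ν := by
    intro k
    rw [integral_smul_measure, ENNReal.toReal_ofReal (by positivity),
      integral_map (measurable_sumDirac k).aemeasurable hh.aestronglyMeasurable, real_smul]
  simp only [hk] at hs
  exact hs

theorem measurable_finitePointMeasures_apply {D : Set X} (hD : MeasurableSet D) :
    Measurable fun ξ : finitePointMeasures X => ξ.1 D :=
  (Measure.measurable_coe hD).comp measurable_subtype_coe

theorem norm_cexp_ofReal_mul_I_le (x : ℝ) : ‖cexp ((x : ℂ) * I)‖ ≤ 1 :=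
  (norm_exp_ofReal_mul_I x).le

/-- By disjointness a point lies in at most one `D j`, so the exponential of the sum becomes affine
in the indicators. -/
theorem cexp_sum_indicator {X : Type*} {m : ℕ} {D : Fin m → Set X}
    (hdisj : Pairwise fun i j => Disjoint (D i) (D j)) (t : Fin m → ℝ) (x : X) :
    cexp (((∑ j, t j * (D j).indicator (1 : X → ℝ) x : ℝ) : ℂ) * I) =
      1 + ∑ j, (D j).indicator (fun _ => cexp (t j * I) - 1) x := by
  by_cases hx : ∃ j, x ∈ D j
  · obtain ⟨j, hj⟩ := hx
    have hne : ∀ i, i ≠ j → x ∉ D i := fun i hij hi => Set.disjoint_left.1 (hdisj hij) hi hj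
    rw [Finset.sum_eq_single j (fun i _ hij => by simp [hne i hij]) (by simp),
      Finset.sum_eq_single j (fun i _ hij => by simp [hne i hij]) (by simp)]
    simp [hj]
  · push Not at hx
    simp [hx]

/-- Given `k` points the integrand factorises as `∏ G (x i)` and integrates to `(∫ G) ^ k`. Summing
the exponential series gives `exp (∫ G - ν(X))`. -/
theorem massCharFun_poissonLaw {m : ℕ} {D : Fin m → Set X} (hD : ∀ i, MeasurableSet (D i))
    (hdisj : Pairwise fun i j => Disjoint (D i) (D j)) (t : Fin m → ℝ) :
    massCharFun (fun ξ : finitePointMeasures X => ξ.1) (poissonLaw ν) D t =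
      cexp (∑ i, ((ν (D i)).toReal : ℂ) * (cexp (t i * I) - 1)) := by
  set G : X → ℂ := fun x => cexp (((∑ j, t j * (D j).indicator (1 : X → ℝ) x : ℝ) : ℂ) * I)
  have hmeas : Measurable fun ξ : finitePointMeasures X =>
      cexp (((∑ j, t j * (ξ.1 (D j)).toReal : ℝ) : ℂ) * I) := by
    have h : ∀ j, Measurable fun ξ : finitePointMeasures X => (ξ.1 (D j)).toReal := fun j =>
      (measurable_finitePointMeasures_apply (hD j)).ennreal_toReal
    fun_prop
  have hsum := hasSum_integral_poissonLaw ν hmeas fun _ => norm_cexp_ofReal_mul_I_le _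
  have hprod : ∀ (k : ℕ) (x : Fin k → X),
      cexp (((∑ j, t j * ((sumDirac x).1 (D j)).toReal : ℝ) : ℂ) * I) = ∏ i, G (x i) := by
    intro k x
    simp only [G, ← Complex.exp_sum, ← Finset.sum_mul, ← ofReal_sum,
      toReal_sumDirac_apply x (hD _), Finset.mul_sum]
    rw [Finset.sum_comm]
  simp only [hprod, integral_fintype_prod_eq_pow, Fintype.card_fin] at hsum
  have hG : ∫ x, G x ∂ν = (ν Set.univ).toReal +
      ∑ i, ((ν (D i)).toReal : ℂ) * (cexp (t i * I) - 1) := by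
    simp only [G, cexp_sum_indicator hdisj]
    have hi : ∀ j, Integrable (fun x => (D j).indicator (fun _ => cexp (t j * I) - 1) x) ν :=
      fun j => (integrable_const _).indicator (hD j)
    rw [integral_add (integrable_const _) (integrable_finsetSum _ fun j _ => hi j),
      integral_finsetSum _ fun j _ => hi j]
    simp [integral_indicator (hD _), measureReal_def]
  have hexp : HasSum (fun k : ℕ => ((Real.exp (-(ν Set.univ).toReal) / k.factorial : ℝ) : ℂ) *
      (∫ x, G x ∂ν) ^ k) (cexp (-(ν Set.univ).toReal) * cexp (∫ x, G x ∂ν)) := by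
    have := (NormedSpace.expSeries_div_hasSum_exp (∫ x, G x ∂ν)).mul_left
      (cexp (-(ν Set.univ).toReal))
    rw [← exp_eq_exp_ℂ] at this
    have he : ∀ k : ℕ, ((Real.exp (-(ν Set.univ).toReal) / k.factorial : ℝ) : ℂ) *
        (∫ x, G x ∂ν) ^ k = cexp (-(ν Set.univ).toReal) * ((∫ x, G x ∂ν) ^ k / k.factorial) := by
      intro k
      push_cast
      ring
    simp only [he]
    exact this
  rw [massCharFun, hsum.unique hexp, ← Complex.exp_add, hG, neg_add_cancel_left]

theorem isPoissonPointProcess_poissonLaw :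
    IsPoissonPointProcess ν (fun ξ : finitePointMeasures X => ξ.1) (poissonLaw ν) :=
  isPoissonPointProcess_of_massCharFun measurable_subtype_coe
    (fun _ _ _ => ae_of_all _ fun _ => measure_ne_top _ _)
    (fun D _ h => (measure_ne_top ν D h).elim)
    fun _ _ t hD hdisj _ => massCharFun_poissonLaw ν hD hdisj t

theorem measurable_add_finitePointMeasures :
    Measurable fun p : finitePointMeasures X × finitePointMeasures X => p.1 + p.2 := by
  refine Measurable.subtype_mk ?_
  exact (measurable_subtype_coe.comp measurable_fst).add (measurable_subtype_coe.comp measurable_snd)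

theorem monotone_add_finitePointMeasures :
    Monotone fun p : finitePointMeasures X × finitePointMeasures X => p.1 + p.2 :=
  fun _ _ h => add_le_add (α := Measure X) h.1 h.2

theorem eq_of_map_subtype_val_eq {α : Type*} [MeasurableSpace α] {p : α → Prop}
    {P P' : Measure (Subtype p)} (h : P.map Subtype.val = P'.map Subtype.val) : P = P' := by
  ext s hs
  obtain ⟨t, ht, rfl⟩ := hs
  rw [← Measure.map_apply measurable_subtype_coe ht, h,
    Measure.map_apply measurable_subtype_coe ht]

/-- The Poisson point process with intensity `ν + ν'` is the superposition of independent Poisson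
point processes with intensities `ν` and `ν'`. -/
theorem poissonLaw_add (ν' : Measure X) [IsFiniteMeasure ν'] :
    poissonLaw (ν + ν') = ((poissonLaw ν).prod (poissonLaw ν')).map (fun p => p.1 + p.2) := by
  have h : IsPoissonPointProcess (ν + ν')
      (fun p : finitePointMeasures X × finitePointMeasures X => (p.1 + p.2).1)
      ((poissonLaw ν).prod (poissonLaw ν')) := by
    refine isPoissonPointProcess_of_massCharFun
      (measurable_subtype_coe.comp measurable_add_finitePointMeasures)
      (fun _ _ _ => ae_of_all _ fun p => measure_ne_top (p.1 + p.2).1 _)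
      (fun D _ h => (measure_ne_top (ν + ν') D h).elim) fun m D t hD hdisj _ => ?_
    have hsplit : ∀ p : finitePointMeasures X × finitePointMeasures X,
        cexp (((∑ i, t i * ((p.1 + p.2).1 (D i)).toReal : ℝ) : ℂ) * I) =
          cexp (((∑ i, t i * (p.1.1 (D i)).toReal : ℝ) : ℂ) * I) *
            cexp (((∑ i, t i * (p.2.1 (D i)).toReal : ℝ) : ℂ) * I) := by
      intro p
      rw [← Complex.exp_add, ← add_mul, ← ofReal_add, ← Finset.sum_add_distrib]
      simp only [← mul_add, AddSubmonoid.coe_add, Measure.coe_add, Pi.add_apply,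
        ENNReal.toReal_add (measure_ne_top p.1.1 _) (measure_ne_top p.2.1 _)]
    have h1 := massCharFun_poissonLaw ν hD hdisj t
    have h2 := massCharFun_poissonLaw ν' hD hdisj t
    rw [massCharFun] at h1 h2 ⊢
    simp_rw [hsplit]
    rw [integral_prod_mul (fun ξ : finitePointMeasures X =>
        cexp (((∑ i, t i * (ξ.1 (D i)).toReal : ℝ) : ℂ) * I))
      (fun ξ : finitePointMeasures X =>
        cexp (((∑ i, t i * (ξ.1 (D i)).toReal : ℝ) : ℂ) * I)), h1, h2, ← Complex.exp_add,
      ← Finset.sum_add_distrib]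
    simp only [← add_mul, ← ofReal_add, Measure.coe_add, Pi.add_apply,
      ENNReal.toReal_add (measure_ne_top ν _) (measure_ne_top ν' _)]
  -- Characteristic functions multiply under independent sums, so both sides are Poisson with
  -- intensity `ν + ν'`, and uniqueness identifies them as laws on `Measure X`.
  refine eq_of_map_subtype_val_eq ?_
  rw [Measure.map_map measurable_subtype_coe measurable_add_finitePointMeasures]
  exact (isPoissonPointProcess_poissonLaw (ν + ν')).map_eq h

/-- The probability of being nonempty is `1 - exp (-m)` with `m = ν(X)`, and `1 - exp (-m) ≤ m`. -/
theorem poissonLaw_real_ne_zero_le :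
    (poissonLaw ν).real {ξ | ξ.1 Set.univ ≠ 0} ≤ (ν Set.univ).toReal := by
  have hS : MeasurableSet {ξ : finitePointMeasures X | ξ.1 Set.univ = 0} :=
    measurable_finitePointMeasures_apply MeasurableSet.univ (measurableSet_singleton 0)
  have h := (isPoissonPointProcess_poissonLaw ν).map_apply_eq_poisson Set.univ MeasurableSet.univ
    (measure_ne_top ν _)
  have h0 := congrArg (fun μ => μ.real {0}) h
  simp only [measureReal_def] at h0
  rw [Measure.map_apply (measurable_finitePointMeasures_apply MeasurableSet.univ)
    (measurableSet_singleton 0), Measure.map_apply (by fun_prop) (measurableSet_singleton 0)] at h0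
  have hpre : (fun n : ℕ => (n : ℝ≥0∞)) ⁻¹' {0} = {0} := by
    ext n
    simp
  rw [hpre, ← measureReal_def, ← measureReal_def, poissonMeasure_real_singleton] at h0
  have hc : {ξ : finitePointMeasures X | ξ.1 Set.univ ≠ 0} =
      {ξ : finitePointMeasures X | ξ.1 Set.univ = 0}ᶜ := rfl
  rw [hc, probReal_compl_eq_one_sub hS]
  have h1 : (poissonLaw ν).real {ξ : finitePointMeasures X | ξ.1 Set.univ = 0} =
      Real.exp (-(ν Set.univ).toReal) := by
    refine h0.trans ?_
    simp [ENNReal.coe_toNNReal_eq_toReal]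
  rw [h1]
  linarith [Real.add_one_le_exp (-(ν Set.univ).toReal)]

/-- Halving the intensity divides the quadratic error by four, while superposing the two independent
halves only doubles it. Each step thus gains a factor of two. -/
theorem fkgUpTo_poissonLaw_div_two_pow (k : ℕ) : ∀ (ν : Measure X) [IsFiniteMeasure ν],
    FKGUpTo (poissonLaw ν) ((ν Set.univ).toReal ^ 2 / 2 ^ k) := by
  induction k with
  | zero =>
    intro ν _
    have hS : MeasurableSet {ξ : finitePointMeasures X | ξ.1 Set.univ = 0} :=
      measurable_finitePointMeasures_apply MeasurableSet.univ (measurableSet_singleton 0)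
    rw [pow_zero, div_one]
    refine fkgUpTo_of_real_le (a := 0) (fun ξ => Measure.zero_le ξ.1) hS.compl (fun ξ hξ => ?_)
      (poissonLaw_real_ne_zero_le ν)
    have hξ0 : ξ.1 Set.univ = 0 := not_not.1 hξ
    have : ξ = 0 := Subtype.ext (Measure.measure_univ_eq_zero.1 hξ0)
    exact this.le
  | succ k ih =>
    intro ν _
    have hν : ν = (2⁻¹ : ℝ≥0) • ν + (2⁻¹ : ℝ≥0) • ν := by
      rw [← add_smul]
      norm_num
    have h := ih ((2⁻¹ : ℝ≥0) • ν)
    have h2 := (h.prod h).map measurable_add_finitePointMeasures monotone_add_finitePointMeasures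
    rw [← poissonLaw_add, ← hν] at h2
    refine h2.mono (le_of_eq ?_)
    have : (((2⁻¹ : ℝ≥0) • ν) Set.univ).toReal = (ν Set.univ).toReal / 2 := by
      rw [Measure.smul_apply, ENNReal.toReal_smul, NNReal.smul_def]
      simp
      ring
    rw [this, pow_succ]
    ring

/-- A Poisson point process with finite intensity measure satisfies the FKG inequality. -/
theorem fkgUpTo_poissonLaw : FKGUpTo (poissonLaw ν) 0 := by
  refine fkgUpTo_zero_of_forall fun ε hε => ?_
  have hlim : Filter.Tendsto (fun k : ℕ => (ν Set.univ).toReal ^ 2 / 2 ^ k) Filter.atTop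
      (nhds 0) := tendsto_const_nhds.div_atTop (tendsto_pow_atTop_atTop_of_one_lt one_lt_two)
  obtain ⟨k, hk⟩ := (hlim.eventually (gt_mem_nhds hε)).exists
  exact (fkgUpTo_poissonLaw_div_two_pow k ν).mono hk.le

end FinitePoisson

/-! ### Sigma-finite intensities by superposition -/

section Superposition

open Complex

theorem lintegral_natCast_poissonMeasure (r : ℝ≥0) : ∫⁻ n, (n : ℝ≥0∞) ∂poissonMeasure r = r := by
  rw [poissonMeasure, lintegral_sum_measure]
  simp only [lintegral_smul_measure, lintegral_dirac, smul_eq_mul]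
  -- The term `n = 0` vanishes; in the others the factor `n + 1` cancels against the factorial,
  -- leaving `r` times the Poisson weights.
  rw [tsum_eq_zero_add' ENNReal.summable]
  have : ∀ n : ℕ, ENNReal.ofReal (Real.exp (-r) * r ^ (n + 1) / (n + 1).factorial) *
      ((n + 1 : ℕ) : ℝ≥0∞) = r * ENNReal.ofReal (Real.exp (-r) * r ^ n / n.factorial) := by
    intro n
    rw [← ENNReal.ofReal_natCast, ← ENNReal.ofReal_mul (by positivity), ← ENNReal.ofReal_coe_nnreal,
      ← ENNReal.ofReal_mul (by positivity)]
    congr 1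
    rw [Nat.factorial_succ]
    push_cast
    field_simp
    ring
  simp only [this, ENNReal.tsum_mul_left]
  rw [← ENNReal.ofReal_tsum_of_nonneg (fun n => by positivity)
    (hasSum_one_poissonMeasure r).summable, (hasSum_one_poissonMeasure r).tsum_eq]
  simp

theorem tendsto_poissonMeasure_Iic (k : ℕ) :
    Filter.Tendsto (fun r : ℝ≥0 => poissonMeasure r (Set.Iic k)) Filter.atTop (nhds 0) := by
  have h : ∀ r : ℝ≥0, poissonMeasure r (Set.Iic k) =
      ∑ n ∈ Finset.Iic k, ENNReal.ofReal (Real.exp (-r) * r ^ n / n.factorial) := by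
    intro r
    rw [← Finset.coe_Iic, ← sum_measure_singleton]
    simp only [poissonMeasure_singleton]
  simp only [h]
  rw [← Finset.sum_const_zero (s := Finset.Iic k)]
  refine tendsto_finsetSum _ fun n _ => ?_
  rw [← ENNReal.ofReal_zero]
  refine ENNReal.tendsto_ofReal ?_
  have := ((Real.tendsto_pow_mul_exp_neg_atTop_nhds_zero n).comp
    (NNReal.tendsto_coe_atTop.2 Filter.tendsto_id)).div_const (n.factorial : ℝ)
  simpa [Function.comp_def, mul_comm] using this

variable {Ω X : Type*} [MeasurableSpace Ω] [MeasurableSpace X]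

theorem IsPoissonPointProcess.lintegral_apply {ν : Measure X} {ξ : Ω → Measure X} {P : Measure Ω}
    (h : IsPoissonPointProcess ν ξ P) {D : Set X} (hD : MeasurableSet D) (hν : ν D ≠ ∞) :
    ∫⁻ ω, ξ ω D ∂P = ν D := by
  have hm : Measurable fun ω => ξ ω D := (Measure.measurable_coe hD).comp h.measurable
  have h1 : ∫⁻ ω, ξ ω D ∂P = ∫⁻ x, x ∂(P.map fun ω => ξ ω D) := by
    rw [lintegral_map (f := fun x => x) measurable_id hm]
  rw [h1, h.map_apply_eq_poisson D hD hν, lintegral_map (f := fun x => x) measurable_id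
    (by fun_prop)]
  exact (lintegral_natCast_poissonMeasure _).trans (ENNReal.coe_toNNReal hν)

/-- The superposition of the restrictions of the point measures `x n` to the sets `C n`. -/
noncomputable def superposition (C : ℕ → Set X) (x : ℕ → finitePointMeasures X) : Measure X :=
  Measure.sum fun n => (x n).1.restrict (C n)

/-- The superposition of the restrictions of `x n` to `C n` for `n < N`. -/
noncomputable def partialSuperposition (C : ℕ → Set X) (N : ℕ) (x : ℕ → finitePointMeasures X) :
    Measure X :=
  ∑ n ∈ Finset.range N, (x n).1.restrict (C n)

theorem superposition_apply (C : ℕ → Set X) (x : ℕ → finitePointMeasures X) {D : Set X}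
    (hD : MeasurableSet D) : superposition C x D = ∑' n, (x n).1 (D ∩ C n) := by
  rw [superposition, Measure.sum_apply _ hD]
  simp only [Measure.restrict_apply hD]

theorem partialSuperposition_apply (C : ℕ → Set X) (N : ℕ) (x : ℕ → finitePointMeasures X)
    {D : Set X} (hD : MeasurableSet D) :
    partialSuperposition C N x D = ∑ n ∈ Finset.range N, (x n).1 (D ∩ C n) := by
  simp only [partialSuperposition, Measure.coe_finsetSum, Finset.sum_apply,
    Measure.restrict_apply hD]

instance (C : ℕ → Set X) (N : ℕ) (x : ℕ → finitePointMeasures X) :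
    IsFiniteMeasure (partialSuperposition C N x) := by
  unfold partialSuperposition
  infer_instance

theorem tendsto_partialSuperposition_apply (C : ℕ → Set X) (x : ℕ → finitePointMeasures X)
    {D : Set X} (hD : MeasurableSet D) :
    Filter.Tendsto (fun N => partialSuperposition C N x D) Filter.atTop
      (nhds (superposition C x D)) := by
  simp only [partialSuperposition_apply C _ x hD, superposition_apply C x hD]
  exact ENNReal.tendsto_nat_tsum _

theorem partialSuperposition_apply_le (C : ℕ → Set X) (N : ℕ) (x : ℕ → finitePointMeasures X)
    {D : Set X} (hD : MeasurableSet D) : partialSuperposition C N x D ≤ superposition C x D := by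
  rw [partialSuperposition_apply C _ x hD, superposition_apply C x hD]
  exact ENNReal.sum_le_tsum _

variable {C : ℕ → Set X}

theorem measurable_coord_apply (n : ℕ) {D : Set X} (hD : MeasurableSet D) :
    Measurable fun x : ℕ → finitePointMeasures X => (x n).1 D :=
  (measurable_finitePointMeasures_apply hD).comp (measurable_pi_apply n)

theorem measurable_superposition (hC : ∀ n, MeasurableSet (C n)) :
    Measurable (superposition C) := by
  refine Measure.measurable_of_measurable_coe _ fun D hD => ?_
  simp only [superposition_apply C _ hD]
  exact Measurable.tsum fun n => measurable_coord_apply n (hD.inter (hC n))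

theorem measurable_partialSuperposition (hC : ∀ n, MeasurableSet (C n)) (N : ℕ) :
    Measurable (partialSuperposition C N) := by
  refine Measure.measurable_of_measurable_coe _ fun D hD => ?_
  simp only [partialSuperposition_apply C _ _ hD]
  exact Finset.measurable_fun_sum _ fun n _ => measurable_coord_apply n (hD.inter (hC n))

theorem monotone_superposition : Monotone (superposition C) := by
  intro x y h
  refine Measure.le_iff.2 fun D hD => ?_
  rw [superposition_apply C x hD, superposition_apply C y hD]
  exact ENNReal.tsum_le_tsum fun n => h n _

theorem measure_eq_tsum_restrict (ν : Measure X) (hC : ∀ n, MeasurableSet (C n))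
    (hdisj : Pairwise fun i j => Disjoint (C i) (C j)) (hcover : ⋃ n, C n = Set.univ) {D : Set X}
    (hD : MeasurableSet D) : ν D = ∑' n, ν.restrict (C n) D := by
  rw [← Measure.sum_apply _ hD, ← Measure.restrict_iUnion hdisj hC, hcover,
    Measure.restrict_univ]

variable (ν : Measure X) [∀ n, IsFiniteMeasure (ν.restrict (C n))]

/-- The coordinates are independent, so the characteristic function is a product of those of the
pieces, evaluated on the sets `D i ∩ C n`. -/
theorem massCharFun_partialSuperposition (hC : ∀ n, MeasurableSet (C n)) (N : ℕ) {m : ℕ}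
    {D : Fin m → Set X} (hD : ∀ i, MeasurableSet (D i))
    (hdisj : Pairwise fun i j => Disjoint (D i) (D j)) (t : Fin m → ℝ) :
    massCharFun (partialSuperposition C N)
      (Measure.infinitePi fun n => poissonLaw (ν.restrict (C n))) D t =
      cexp (∑ i, (((∑ n ∈ Finset.range N, ν.restrict (C n)) (D i)).toReal : ℂ) *
        (cexp (t i * I) - 1)) := by
  set P := Measure.infinitePi fun n => poissonLaw (ν.restrict (C n))
  let h : ℕ → finitePointMeasures X → ℂ := fun n ξ =>
    cexp (((∑ i, t i * (ξ.1 (D i ∩ C n)).toReal : ℝ) : ℂ) * I)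
  have hm : ∀ n, Measurable (h n) := by
    intro n
    have h : ∀ j, Measurable fun ξ : finitePointMeasures X => (ξ.1 (D j ∩ C n)).toReal := fun j =>
      (measurable_finitePointMeasures_apply ((hD j).inter (hC n))).ennreal_toReal
    fun_prop
  have hsplit : ∀ x, cexp (((∑ i, t i * (partialSuperposition C N x (D i)).toReal : ℝ) : ℂ) * I) =
      ∏ n : Fin N, h n (x n) := by
    intro x
    rw [← Finset.prod_range fun n => h n (x n)]
    simp only [h]
    rw [← Complex.exp_sum, ← Finset.sum_mul, ← ofReal_sum, Finset.sum_comm]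
    simp only [partialSuperposition_apply C N x (hD _), ← Finset.mul_sum,
      ENNReal.toReal_sum fun n _ => measure_ne_top (x n).1 _]
  have hindep : iIndepFun (fun (n : Fin N) (x : ℕ → finitePointMeasures X) => x n) P :=
    (iIndepFun_infinitePi (P := fun n => poissonLaw (ν.restrict (C n)))
      (X := fun _ ξ => ξ) fun _ => measurable_id).precomp Fin.val_injective
  have hcoord : ∀ n : ℕ, ∫ x, h n (x n) ∂P =
      cexp (∑ i, (((ν.restrict (C n)) (D i)).toReal : ℂ) * (cexp (t i * I) - 1)) := by
    intro n
    have h1 := massCharFun_poissonLaw (ν.restrict (C n)) (fun i => (hD i).inter (hC n))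
      (fun i j hij => (hdisj hij).mono Set.inter_subset_left Set.inter_subset_left) t
    simp only [Measure.restrict_apply ((hD _).inter (hC n)), Set.inter_assoc, Set.inter_self,
      massCharFun] at h1
    simp only [Measure.restrict_apply (hD _)]
    rw [← h1, ← Measure.infinitePi_map_eval (fun n => poissonLaw (ν.restrict (C n))) n,
      integral_map (measurable_pi_apply n).aemeasurable (hm n).aestronglyMeasurable]
  rw [massCharFun]
  simp only [hsplit]
  rw [hindep.integral_fun_prod_comp (fun _ => (measurable_pi_apply _).aemeasurable)
    fun n => (hm n).aestronglyMeasurable]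
  simp only [hcoord]
  rw [← Finset.prod_range fun n => cexp (∑ i, (((ν.restrict (C n)) (D i)).toReal : ℂ) *
    (cexp (t i * I) - 1)), ← Complex.exp_sum, Finset.sum_comm]
  congr 1
  refine Finset.sum_congr rfl fun i _ => ?_
  rw [← Finset.sum_mul, ← ofReal_sum, Measure.coe_finsetSum, Finset.sum_apply,
    ENNReal.toReal_sum fun n _ => measure_ne_top (ν.restrict (C n)) _]

theorem isPoissonPointProcess_partialSuperposition (hC : ∀ n, MeasurableSet (C n)) (N : ℕ) :
    IsPoissonPointProcess (∑ n ∈ Finset.range N, ν.restrict (C n)) (partialSuperposition C N)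
      (Measure.infinitePi fun n => poissonLaw (ν.restrict (C n))) :=
  isPoissonPointProcess_of_massCharFun (measurable_partialSuperposition hC N)
    (fun _ _ _ => ae_of_all _ fun _ => measure_ne_top _ _)
    (fun D _ h => (measure_ne_top _ D h).elim)
    fun _ _ t hD hdisj _ => massCharFun_partialSuperposition ν hC N hD hdisj t

/-- The superposition of independent Poisson point processes on the pieces of a countable partition
is a Poisson point process. -/
theorem isPoissonPointProcess_superposition (hC : ∀ n, MeasurableSet (C n))
    (hdisj : Pairwise fun i j => Disjoint (C i) (C j)) (hcover : ⋃ n, C n = Set.univ) :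
    IsPoissonPointProcess ν (superposition C)
      (Measure.infinitePi fun n => poissonLaw (ν.restrict (C n))) := by
  set P := Measure.infinitePi fun n => poissonLaw (ν.restrict (C n))
  let νN : ℕ → Measure X := fun N => ∑ n ∈ Finset.range N, ν.restrict (C n)
  have hpart : ∀ N, IsPoissonPointProcess (νN N) (partialSuperposition C N) P :=
    isPoissonPointProcess_partialSuperposition ν hC
  have hν : ∀ {D : Set X}, MeasurableSet D →
      Filter.Tendsto (fun N => νN N D) Filter.atTop (nhds (ν D)) := by
    intro D hD
    rw [measure_eq_tsum_restrict ν hC hdisj hcover hD]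
    simp only [νN, Measure.coe_finsetSum, Finset.sum_apply]
    exact ENNReal.tendsto_nat_tsum _
  have hfin : ∀ D, MeasurableSet D → ν D ≠ ∞ → ∀ᵐ x ∂P, superposition C x D ≠ ∞ := by
    intro D hD hνD
    -- Almost sure finiteness follows from the finite mean, which is computed piece by piece.
    have hmean : ∫⁻ x, superposition C x D ∂P = ν D := by
      simp only [superposition_apply C _ hD]
      rw [lintegral_tsum fun n => (measurable_coord_apply n (hD.inter (hC n))).aemeasurable,
        measure_eq_tsum_restrict ν hC hdisj hcover hD]
      refine tsum_congr fun n => ?_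
      have h1 := (isPoissonPointProcess_poissonLaw (ν.restrict (C n))).lintegral_apply
        (hD.inter (hC n)) (measure_ne_top _ _)
      rw [Measure.restrict_apply (hD.inter (hC n)), Set.inter_assoc, Set.inter_self] at h1
      rw [Measure.restrict_apply hD, ← h1,
        ← Measure.infinitePi_map_eval (fun n => poissonLaw (ν.restrict (C n))) n,
        lintegral_map (measurable_finitePointMeasures_apply (hD.inter (hC n)))
          (measurable_pi_apply n)]
    filter_upwards [ae_lt_top ((Measure.measurable_coe hD).comp (measurable_superposition hC))
      (by simpa only [Function.comp_def, hmean] using hνD)] with x hx using hx.ne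
  have htop : ∀ D, MeasurableSet D → ν D = ∞ → ∀ᵐ x ∂P, superposition C x D = ∞ := by
    intro D hD hνD
    have hsub : {x | ¬ superposition C x D = ∞} ⊆ ⋃ k : ℕ, {x | superposition C x D ≤ k} := by
      intro x hx
      obtain ⟨k, hk⟩ := ENNReal.exists_nat_gt hx
      exact Set.mem_iUnion.2 ⟨k, hk.le⟩
    refine measure_mono_null hsub (measure_iUnion_null fun k => ?_)
    -- The superposition dominates its partial sums, whose mass on `D` is Poisson with parameter
    -- tending to infinity. Hence it is at most `k` with probability `0`.
    have hr : Filter.Tendsto (fun N => (νN N D).toNNReal) Filter.atTop Filter.atTop := by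
      rw [← ENNReal.tendsto_coe_nhds_top, ← hνD]
      simpa only [ENNReal.coe_toNNReal (measure_ne_top (νN _) D)] using hν hD
    refine le_antisymm (ge_of_tendsto' ((tendsto_poissonMeasure_Iic k).comp hr) fun N => ?_) zero_le
    have h1 := (hpart N).map_apply_eq_poisson D hD (measure_ne_top _ _)
    have hm := (Measure.measurable_coe hD).comp (measurable_partialSuperposition hC N)
    calc P {x | superposition C x D ≤ k} ≤ P {x | partialSuperposition C N x D ≤ k} :=
          measure_mono fun x hx => (partialSuperposition_apply_le C N x hD).trans hx
      _ = (P.map fun x => partialSuperposition C N x D) (Set.Iic (k : ℝ≥0∞)) :=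
          (Measure.map_apply hm measurableSet_Iic).symm
      _ = poissonMeasure (νN N D).toNNReal (Set.Iic k) := by
          rw [h1, Measure.map_apply (by fun_prop) measurableSet_Iic]
          congr 1
          ext n
          simp
  refine isPoissonPointProcess_of_massCharFun (measurable_superposition hC) hfin htop
    fun m D t hD hdisj' hνD => ?_
  -- The formula for partial sums passes to the limit by dominated convergence, as the integrands
  -- have modulus one.
  have hlim1 : Filter.Tendsto (fun N => massCharFun (partialSuperposition C N) P D t) Filter.atTop
      (nhds (massCharFun (superposition C) P D t)) := by
    refine tendsto_integral_of_dominated_convergence (fun _ => 1) (fun N => ?_)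
      (integrable_const _) (fun N => ae_of_all _ fun _ => norm_cexp_ofReal_mul_I_le _) ?_
    · have h : ∀ j, Measurable fun x => (partialSuperposition C N x (D j)).toReal := fun j =>
        ((Measure.measurable_coe (hD j)).comp
          (measurable_partialSuperposition hC N)).ennreal_toReal
      exact Measurable.aestronglyMeasurable (by fun_prop)
    · filter_upwards [ae_all_iff.2 fun i => hfin (D i) (hD i) (hνD i)] with x hx
      have h1 : Filter.Tendsto (fun N => ∑ i, t i * (partialSuperposition C N x (D i)).toReal)
          Filter.atTop (nhds (∑ i, t i * (superposition C x (D i)).toReal)) :=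
        tendsto_finsetSum _ fun i _ => ((ENNReal.tendsto_toReal (hx i)).comp
          (tendsto_partialSuperposition_apply C x (hD i))).const_mul _
      have h2 : Continuous fun r : ℝ => cexp ((r : ℂ) * I) := by fun_prop
      exact (h2.tendsto _).comp h1
  have hchar : ∀ N, massCharFun (partialSuperposition C N) P D t =
      cexp (∑ i, ((νN N (D i)).toReal : ℂ) * (cexp (t i * I) - 1)) := fun N =>
    massCharFun_partialSuperposition ν hC N hD hdisj' t
  simp only [hchar] at hlim1
  refine tendsto_nhds_unique hlim1 ?_
  refine (Complex.continuous_exp.tendsto _).comp (tendsto_finsetSum _ fun i _ => ?_)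
  refine Filter.Tendsto.mul_const _ ?_
  exact (Complex.continuous_ofReal.tendsto _).comp
    ((ENNReal.tendsto_toReal (hνD i)).comp (hν (hD i)))

/-- The superposition satisfies the FKG inequality. -/
theorem satisfiesFKG_infinitePi_poissonLaw :
    SatisfiesFKG (Measure.infinitePi fun n => poissonLaw (ν.restrict (C n))) :=
  satisfiesFKG_infinitePi _ fun _ => fkgUpTo_poissonLaw _

end Superposition

/-! ### Countable sums of Dirac masses -/

section PointMeasure

variable {X : Type*} [MeasurableSpace X]

/-- Countable sums of Dirac masses, indexed by a set of natural numbers. -/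
def IsPointMeasure (μ : Measure X) : Prop :=
  ∃ (I : Set ℕ) (w : I → X), μ = Measure.sum fun i => Measure.dirac (w i)

theorem isPointMeasure_sum_dirac {ι : Type*} [Countable ι] (w : ι → X) :
    IsPointMeasure (Measure.sum fun i => Measure.dirac (w i)) := by
  obtain ⟨f, hf⟩ := exists_injective_nat ι
  let e := Equiv.ofInjective f hf
  refine ⟨Set.range f, fun n => w (e.symm n), ?_⟩
  ext s hs
  rw [Measure.sum_apply _ hs, Measure.sum_apply _ hs]
  exact (e.symm.tsum_eq fun i => Measure.dirac (w i) s).symm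

theorem IsPointMeasure.sum {ι : Type*} [Countable ι] {μ : ι → Measure X}
    (h : ∀ i, IsPointMeasure (μ i)) : IsPointMeasure (Measure.sum μ) := by
  choose I w hw using h
  have : Measure.sum μ = Measure.sum fun p : Σ i, I i => Measure.dirac (w p.1 p.2) := by
    ext s hs
    rw [Measure.sum_apply _ hs, Measure.sum_apply _ hs, ENNReal.tsum_sigma']
    refine tsum_congr fun i => ?_
    rw [hw i, Measure.sum_apply _ hs]
  rw [this]
  exact isPointMeasure_sum_dirac _

theorem IsPointMeasure.restrict {μ : Measure X} (h : IsPointMeasure μ) {s : Set X}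
    (hs : MeasurableSet s) : IsPointMeasure (μ.restrict s) := by
  obtain ⟨I, w, rfl⟩ := h
  have : (Measure.sum fun i => Measure.dirac (w i)).restrict s =
      Measure.sum fun i : {i // w i ∈ s} => Measure.dirac (w i) := by
    ext t ht
    rw [Measure.restrict_apply ht, Measure.sum_apply _ (ht.inter hs), Measure.sum_apply _ ht]
    refine Eq.trans (tsum_congr fun i => ?_)
      (tsum_subtype {i | w i ∈ s} fun i => Measure.dirac (w i) t).symm
    by_cases hi : w i ∈ s <;> by_cases hit : w i ∈ t <;>
      simp [hi, hit, Measure.dirac_apply', ht, ht.inter hs]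
  rw [this]
  exact isPointMeasure_sum_dirac _

theorem isPointMeasure_finitePointMeasures (ξ : finitePointMeasures X) : IsPointMeasure ξ.1 := by
  refine AddSubmonoid.closure_induction (motive := fun μ _ => IsPointMeasure μ) ?_ ?_ ?_ ξ.2
  · rintro _ ⟨x, rfl⟩
    simpa using isPointMeasure_sum_dirac fun _ : Unit => x
  · simpa using isPointMeasure_sum_dirac (X := X) fun i : Empty => i.elim
  · intro μ μ' _ _ h h'
    have : μ + μ' = Measure.sum fun b : Bool => if b then μ else μ' := by
      ext s hs
      rw [Measure.sum_apply _ hs, tsum_bool]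
      simp [add_comm]
    rw [this]
    refine IsPointMeasure.sum fun b => ?_
    cases b
    exacts [h', h]

theorem isPointMeasure_superposition {C : ℕ → Set X} (hC : ∀ n, MeasurableSet (C n))
    (x : ℕ → finitePointMeasures X) : IsPointMeasure (superposition C x) :=
  IsPointMeasure.sum fun n => (isPointMeasure_finitePointMeasures (x n)).restrict (hC n)

/-- Since each `x n` is restricted to `C n`, only the pieces with `n < m` charge `B`. Finiteness
thus holds for every `x`, not just almost surely, as a map into the configuration space requires. -/
theorem superposition_lt_top {C : ℕ → Set X} {B : Set X} (hB : MeasurableSet B) {m : ℕ}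
    (hBC : ∀ n, m ≤ n → Disjoint B (C n)) (x : ℕ → finitePointMeasures X) :
    superposition C x B < ∞ := by
  rw [superposition_apply C x hB, tsum_eq_sum (s := Finset.range m)]
  · exact ENNReal.sum_lt_top.2 fun n _ => measure_lt_top _ _
  · intro n hn
    rw [(hBC n (by simpa using hn)).inter_eq, measure_empty]

theorem IsPointMeasure.exists_singleton_ne_zero {μ : Measure X} (h : IsPointMeasure μ) {s : Set X}
    (hs : MeasurableSet s) (hμ : μ s ≠ 0) : ∃ x ∈ s, μ {x} ≠ 0 := by
  obtain ⟨I, w, rfl⟩ := h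
  rw [Measure.sum_apply _ hs] at hμ
  obtain ⟨i, hi⟩ : ∃ i, Measure.dirac (w i) s ≠ 0 := by
    by_contra! h
    exact hμ (by simp [h])
  have hwi : w i ∈ s := by
    by_contra h
    simp [Measure.dirac_apply' _ hs, h] at hi
  refine ⟨w i, hwi, fun h0 => ?_⟩
  -- This bound and the next hold on all sets, so the singleton need not be measurable.
  have h1 := (Measure.le_sum (fun i => Measure.dirac (w i)) i) {w i}
  have h2 : (1 : ℝ≥0∞) ≤ Measure.dirac (w i) {w i} := by
    simp
  rw [h0] at h1
  exact absurd (h2.trans h1) (by simp)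

theorem IsPointMeasure.lintegral_natCast_lt_top {μ : Measure X} (h : IsPointMeasure μ) {s : Set X}
    (hs : MeasurableSet s) (hμ : μ s ≠ ∞) {f : X → ℕ} (hf : Measurable f)
    (hfs : ∀ x, x ∉ s → f x = 0) : ∫⁻ x, f x ∂μ < ∞ := by
  obtain ⟨I, w, rfl⟩ := h
  have hf' : Measurable fun x => (f x : ℝ≥0∞) := by fun_prop
  rw [lintegral_sum_measure]
  simp only [lintegral_dirac' _ hf']
  rw [Measure.sum_apply _ hs] at hμ
  -- Each point in `s` contributes mass one, so finite mass leaves only finitely many points where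
  -- `f` can be nonzero.
  have hfinite := ENNReal.finite_const_le_of_tsum_ne_top hμ one_ne_zero
  rw [tsum_eq_sum (s := hfinite.toFinset)]
  · exact ENNReal.sum_lt_top.2 fun i _ => by simp
  · intro i hi
    rw [Nat.cast_eq_zero]
    refine hfs _ fun his => hi ?_
    simp [Measure.dirac_apply' _ hs, his]

end PointMeasure

theorem IsPoissonPointProcess.map {Ω Ω' X : Type*} [MeasurableSpace Ω] [MeasurableSpace Ω']
    [MeasurableSpace X] {ν : Measure X} {P : Measure Ω} {f : Ω → Ω'} {ξ : Ω' → Measure X}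
    (h : IsPoissonPointProcess ν (fun ω => ξ (f ω)) P) (hf : Measurable f) (hξ : Measurable ξ) :
    IsPoissonPointProcess ν ξ (P.map f) := by
  have := h.isProbabilityMeasure
  have hP := Measure.isProbabilityMeasure_map (μ := P) hf.aemeasurable
  have hm : ∀ {D : Set X}, MeasurableSet D → Measurable fun ω => ξ ω D := fun hD =>
    (Measure.measurable_coe hD).comp hξ
  refine ⟨hP, hξ, fun D hD hν => ?_, fun D hD hν => ?_, fun m D hD hdisj => ?_⟩
  · rw [Measure.map_map (hm hD) hf]
    exact h.map_apply_eq_poisson D hD hν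
  · exact (ae_map_iff hf.aemeasurable (hm hD (measurableSet_singleton ∞))).2
      (h.ae_apply_eq_top D hD hν)
  · have h1 := (iIndepFun_iff_map_fun_eq_pi_map
      fun i => ((hm (hD i)).comp hf).aemeasurable).1 (h.iIndepFun_apply m D hD hdisj)
    rw [iIndepFun_iff_map_fun_eq_pi_map fun i => (hm (hD i)).aemeasurable,
      Measure.map_map (measurable_pi_lambda _ fun i => hm (hD i)) hf]
    simp only [Measure.map_map (hm (hD _)) hf]
    exact h1

/-! ### Trajectories modulo shift and the shell partition -/

namespace WeightedNetwork

variable {V : Type*} (N : WeightedNetwork V)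

theorem proj_surjective : Function.Surjective N.proj := Quotient.mk_surjective

/-- Hitting `K` is invariant under time shift, so `W_K` is saturated for the quotient. -/
theorem proj_mem_hittingClass_iff {w : N.Trajectory} {K : Set V} :
    N.proj w ∈ N.hittingClass K ↔ w ∈ N.hitting K := by
  constructor
  · rintro ⟨w', ⟨n, hn⟩, hw⟩
    obtain ⟨k, hk⟩ : N.shiftSetoid w' w := Quotient.exact hw
    refine ⟨n - k, ?_⟩
    rw [← hk]
    simpa using hn
  · exact fun h => ⟨w, h, rfl⟩

theorem proj_preimage_hittingClass (K : Set V) : N.proj ⁻¹' N.hittingClass K = N.hitting K := by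
  ext w
  exact N.proj_mem_hittingClass_iff

theorem mem_hittingClass_singleton_iff {γ : N.TrajectoryClass} {x : V} :
    γ ∈ N.hittingClass {x} ↔ x ∈ N.range γ := by
  obtain ⟨w, rfl⟩ := N.proj_surjective γ
  rw [proj_mem_hittingClass_iff]
  exact Iff.rfl

theorem hittingClass_mono {K L : Set V} (h : K ⊆ L) : N.hittingClass K ⊆ N.hittingClass L :=
  Set.image_mono fun _ ⟨n, hn⟩ => ⟨n, h hn⟩

theorem hittingClass_empty : N.hittingClass ∅ = ∅ := by
  simp [hittingClass, hitting]

theorem visits_eq_zero {x : V} {γ : N.TrajectoryClass} (h : γ ∉ N.hittingClass {x}) :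
    N.visits x γ = 0 := by
  obtain ⟨w, rfl⟩ := N.proj_surjective γ
  rw [proj_mem_hittingClass_iff] at h
  have : {n | w.1 n = x} = ∅ := Set.eq_empty_of_forall_notMem fun n hn => h ⟨n, hn⟩
  change {n | w.1 n = x}.ncard = 0
  rw [this, Set.ncard_empty]

section Shells

variable {K : ℕ → Finset V}

/-- The trajectories that hit `K (n + 1)` but not `K n`. -/
def shell (K : ℕ → Finset V) (n : ℕ) : Set N.TrajectoryClass :=
  N.hittingClass (K (n + 1)) \ N.hittingClass (K n)

theorem disjoint_hittingClass_shell (hK : Monotone K) {m n : ℕ} (h : m ≤ n) :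
    Disjoint (N.hittingClass (K m)) (N.shell K n) :=
  Set.disjoint_left.2 fun _ hx hx' => hx'.2 (N.hittingClass_mono (hK h) hx)

theorem pairwise_disjoint_shell (hK : Monotone K) :
    Pairwise fun i j => Disjoint (N.shell K i) (N.shell K j) := by
  intro i j hij
  rcases hij.lt_or_gt with h | h
  · exact (N.disjoint_hittingClass_shell hK h).mono_left Set.sdiff_subset
  · exact ((N.disjoint_hittingClass_shell hK h).mono_left Set.sdiff_subset).symm

theorem iUnion_shell (hK_zero : K 0 = ∅) (hK_exh : ∀ x, ∃ n, x ∈ K n) :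
    ⋃ n, N.shell K n = Set.univ := by
  classical
  refine Set.eq_univ_of_forall fun γ => ?_
  have hex : ∃ n, γ ∈ N.hittingClass (K n) := by
    obtain ⟨w, rfl⟩ := N.proj_surjective γ
    obtain ⟨n, hn⟩ := hK_exh (w.1 0)
    exact ⟨n, N.proj_mem_hittingClass_iff.2 ⟨0, hn⟩⟩
  -- The first set of the exhaustion that is hit cannot be `K 0 = ∅`, so its index has a
  -- predecessor, which names the shell.
  obtain ⟨n, hn⟩ : ∃ n, Nat.find hex = n + 1 := by
    refine Nat.exists_eq_succ_of_ne_zero fun h0 => ?_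
    have := Nat.find_spec hex
    rw [h0, hK_zero, Finset.coe_empty, hittingClass_empty] at this
    exact this
  refine Set.mem_iUnion.2 ⟨n, hn ▸ Nat.find_spec hex, Nat.find_min hex (by omega)⟩

end Shells

/-! ### Measurability of hitting events and visit counts -/

section Measurability

variable [MeasurableSpace V]

theorem measurable_proj : Measurable N.proj := measurable_quotient_mk''

theorem measurableSet_iff_preimage_proj {D : Set N.TrajectoryClass} :
    MeasurableSet D ↔ MeasurableSet (N.proj ⁻¹' D) := measurableSet_quotient

variable [DiscreteMeasurableSpace V]

theorem measurableSet_coord (n : ℤ) (K : Set V) : MeasurableSet {w : N.Trajectory | w.1 n ∈ K} :=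
  ((measurable_pi_apply n).comp measurable_subtype_coe) (MeasurableSet.of_discrete (s := K))

theorem measurableSet_hitting (K : Set V) : MeasurableSet (N.hitting K) := by
  have : N.hitting K = ⋃ n, {w | w.1 n ∈ K} := by
    ext w
    simp [hitting]
  rw [this]
  exact MeasurableSet.iUnion fun n => N.measurableSet_coord n K

theorem measurableSet_hittingClass (K : Set V) : MeasurableSet (N.hittingClass K) := by
  rw [measurableSet_iff_preimage_proj, proj_preimage_hittingClass]
  exact N.measurableSet_hitting K

theorem measurableSet_shell {K : ℕ → Finset V} (n : ℕ) : MeasurableSet (N.shell K n) :=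
  (N.measurableSet_hittingClass _).diff (N.measurableSet_hittingClass _)

theorem measurable_visits (x : V) : Measurable (N.visits x) := by
  have h : Measurable fun w : N.Trajectory => ({n | w.1 n = x}.ncard : ℝ≥0∞) := by
    -- Visit sets of a trajectory are finite, so `ncard` is the true count and equals a countable
    -- sum of indicators.
    have : (fun w : N.Trajectory => ({n | w.1 n = x}.ncard : ℝ≥0∞)) =
        fun w => ∑' n, {w : N.Trajectory | w.1 n ∈ ({x} : Set V)}.indicator 1 w := by
      ext w
      have hfin := w.2.2 x
      rw [tsum_eq_sum (s := hfin.toFinset), Set.ncard_eq_toFinset_card _ hfin,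
        Finset.card_eq_sum_ones, Nat.cast_sum]
      · refine Finset.sum_congr rfl fun n hn => ?_
        have : w.1 n = x := by simpa using hn
        simp [this]
      · intro n hn
        have : w.1 n ≠ x := by simpa using hn
        simp [this]
    rw [this]
    exact Measurable.tsum fun n => measurable_one.indicator (N.measurableSet_coord n {x})
  have h2 : Measurable fun w : N.Trajectory => {n | w.1 n = x}.ncard := by
    have := (ENNReal.measurable_toReal.comp h)
    have := Nat.measurable_floor.comp this
    simpa [Function.comp_def] using this
  exact measurable_from_quotient.2 h2

end Measurability

/-! ### Monotone observables of a configuration -/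

section Observables

variable [MeasurableSpace V]

theorem Configuration.isPointMeasure {N : WeightedNetwork V} (ω : N.Configuration) :
    IsPointMeasure ω.1 := ω.2.1

theorem Configuration.hittingClass_lt_top {N : WeightedNetwork V} (ω : N.Configuration) (x : V) :
    ω.1 (N.hittingClass {x}) < ∞ := by
  simpa using ω.2.2 {x}

theorem measurable_configuration_apply {D : Set N.TrajectoryClass} (hD : MeasurableSet D) :
    Measurable fun ω : N.Configuration => ω.1 D :=
  (Measure.measurable_coe hD).comp measurable_subtype_coe

/-- The law of the Poisson point process of trajectories is unique. -/
theorem law_unique {ν : Measure N.TrajectoryClass} {P P' : Measure N.Configuration}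
    (h : IsPoissonPointProcess ν (fun ω : N.Configuration => ω.1) P)
    (h' : IsPoissonPointProcess ν (fun ω : N.Configuration => ω.1) P') : P = P' :=
  eq_of_map_subtype_val_eq (h.map_eq h')

variable [DiscreteMeasurableSpace V]

/-- A point measure that charges a measurable set charges one of its points. This turns the
uncountable union over trajectories into a condition on one measurable set, from which measurability
and monotonicity are read off. -/
theorem mem_interlacementSet_iff {ω : N.Configuration} {x : V} :
    x ∈ N.interlacementSet ω ↔ ω.1 (N.hittingClass {x}) ≠ 0 := by
  simp only [interlacementSet, Set.mem_iUnion, Set.mem_ofPred_eq, exists_prop]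
  constructor
  · rintro ⟨γ, hγ, hx⟩ h0
    refine hγ (measure_mono_null ?_ h0)
    exact Set.singleton_subset_iff.2 (N.mem_hittingClass_singleton_iff.2 hx)
  · intro h
    obtain ⟨γ, hγ, h0⟩ := ω.isPointMeasure.exists_singleton_ne_zero
      (N.measurableSet_hittingClass {x}) h
    exact ⟨γ, h0, N.mem_hittingClass_singleton_iff.1 hγ⟩

theorem measurable_interlacementSet : Measurable N.interlacementSet := by
  refine measurable_set_iff.2 fun x => ?_
  simp only [mem_interlacementSet_iff]
  exact measurableSet_setOfPred.1
    ((N.measurable_configuration_apply (N.measurableSet_hittingClass {x}))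
      (measurableSet_singleton 0).compl)

theorem monotone_interlacementSet : Monotone N.interlacementSet := by
  intro ω ω' h x hx
  rw [mem_interlacementSet_iff] at hx ⊢
  exact fun h0 => hx (le_antisymm ((Configuration.le_iff.1 h _
    (N.measurableSet_hittingClass {x})).trans h0.le) zero_le)

theorem measurable_vacantSet : Measurable N.vacantSet := by
  refine measurable_set_iff.2 fun x => ?_
  exact (measurable_set_iff.1 N.measurable_interlacementSet x).not

theorem antitone_vacantSet : Antitone N.vacantSet := fun _ _ h =>
  Set.compl_subset_compl.2 (N.monotone_interlacementSet h)

theorem measurable_trajectoryCount : Measurable N.trajectoryCount :=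
  measurable_pi_lambda _ fun x => Nat.measurable_floor.comp
    (N.measurable_configuration_apply (N.measurableSet_hittingClass {x})).ennreal_toReal

theorem monotone_trajectoryCount : Monotone N.trajectoryCount := fun _ ω' h x =>
  Nat.floor_mono (ENNReal.toReal_mono (ω'.hittingClass_lt_top x).ne
    (Configuration.le_iff.1 h _ (N.measurableSet_hittingClass {x})))

theorem measurable_localTime : Measurable N.localTime := by
  refine measurable_pi_lambda _ fun x => Nat.measurable_floor.comp (Measurable.ennreal_toReal ?_)
  have hv := N.measurable_visits x
  exact (Measure.measurable_lintegral (by fun_prop)).comp measurable_subtype_coe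

/-- Needed because `toReal` sends `∞` to `0` and is monotone only below a finite bound. -/
theorem lintegral_visits_lt_top (ω : N.Configuration) (x : V) :
    ∫⁻ γ, N.visits x γ ∂ω.1 < ∞ :=
  ω.isPointMeasure.lintegral_natCast_lt_top (N.measurableSet_hittingClass {x})
    (ω.hittingClass_lt_top x).ne (N.measurable_visits x) fun _ => N.visits_eq_zero

theorem monotone_localTime : Monotone N.localTime := fun _ ω' h x =>
  Nat.floor_mono (ENNReal.toReal_mono (N.lintegral_visits_lt_top ω' x).ne (lintegral_mono' h le_rfl))

variable {K : ℕ → Finset V}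

/-- The configuration that consists of the points of `x n` in the `n`-th shell, for all `n`. -/
noncomputable def shellConfiguration (hK : Monotone K) (hK_exh : ∀ x, ∃ n, x ∈ K n)
    (x : ℕ → finitePointMeasures N.TrajectoryClass) : N.Configuration :=
  ⟨superposition (N.shell K) x, isPointMeasure_superposition (fun _ => N.measurableSet_shell _) x,
    fun L => by
      -- A finite set lies in one member of the increasing exhaustion, hence meets only finitely
      -- many shells.
      have hdir : ∃ m, L ⊆ K m := by
        choose f hf using hK_exh
        exact ⟨L.sup f, fun y hy => hK (Finset.le_sup hy) (hf y)⟩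
      obtain ⟨m, hm⟩ := hdir
      exact (measure_mono (N.hittingClass_mono hm)).trans_lt (superposition_lt_top
        (N.measurableSet_hittingClass _) (fun n hn => N.disjoint_hittingClass_shell hK hn) x)⟩

theorem measurable_shellConfiguration (hK : Monotone K) (hK_exh : ∀ x, ∃ n, x ∈ K n) :
    Measurable (N.shellConfiguration hK hK_exh) :=
  Measurable.subtype_mk (measurable_superposition fun _ => N.measurableSet_shell _)

theorem monotone_shellConfiguration (hK : Monotone K) (hK_exh : ∀ x, ∃ n, x ∈ K n) :
    Monotone (N.shellConfiguration hK hK_exh) :=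
  fun _ _ h => monotone_superposition h

end Observables

/-! ### Local finiteness of the intensity and existence of the process -/

section Intensity

variable [Nontrivial V] [Countable V] [MeasurableSpace V] [DiscreteMeasurableSpace V]

instance (x : V) : IsProbabilityMeasure (N.chainLaw x) := by
  unfold chainLaw
  infer_instance

theorem localIntensity_univ_lt_top (K : Finset V) : N.localIntensity K Set.univ < ∞ := by
  have : ∀ x, IsFiniteMeasure (N.equilibrium K x •
    ((cond (N.chainLaw x) (noReturn K)).prod (N.chainLaw x)).map glue) := by
    intro x
    refine Measure.smul_finite _ ?_
    exact (ENNReal.mul_lt_top ENNReal.coe_lt_top (measure_lt_top _ _)).ne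
  have hfin : IsFiniteMeasure (∑ x ∈ K, N.equilibrium K x •
    ((cond (N.chainLaw x) (noReturn K)).prod (N.chainLaw x)).map glue) := inferInstance
  unfold localIntensity
  exact (Measure.comap_apply_le _ _ MeasurableSet.univ.nullMeasurableSet).trans_lt
    (measure_lt_top _ _)

variable {K : ℕ → Finset V}

/-- The intensity measure is finite on the trajectories that hit a set of the exhaustion. -/
theorem intensity_hittingClass_lt_top (hK : Monotone K) (n : ℕ) :
    N.intensity K (N.hittingClass (K n)) < ∞ := by
  rw [intensity, Measure.map_apply N.measurable_proj (N.measurableSet_hittingClass _),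
    proj_preimage_hittingClass, Measure.sum_apply _ (N.measurableSet_hitting _),
    tsum_eq_sum (s := Finset.range n)]
  · exact ENNReal.sum_lt_top.2 fun m _ => (measure_mono (Set.subset_univ _)).trans_lt
      ((Measure.restrict_apply_le _ _).trans_lt (N.localIntensity_univ_lt_top _))
  -- For `m ≥ n` the summand is carried by trajectories avoiding `K m`, which contains `K n`, so
  -- only finitely many finite terms remain.
  · intro m hm
    have hnm : n ≤ m := by simpa using hm
    rw [Measure.restrict_apply (N.measurableSet_hitting _)]
    have : N.hitting (K n) ∩ (N.hitting (K (m + 1)) \ N.hitting (K m)) = ∅ := by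
      ext w
      simp only [Set.mem_inter_iff, Set.mem_sdiff, Set.mem_empty_iff_false, iff_false]
      rintro ⟨⟨k, hk⟩, -, h⟩
      exact h ⟨k, hK hnm hk⟩
    rw [this, measure_empty]

theorem isFiniteMeasure_restrict_shell (hK : Monotone K) (n : ℕ) :
    IsFiniteMeasure ((N.intensity K).restrict (N.shell K n)) := by
  refine ⟨?_⟩
  rw [Measure.restrict_apply_univ]
  exact (measure_mono Set.sdiff_subset).trans_lt (N.intensity_hittingClass_lt_top hK (n + 1))

/-- The Poisson point process of trajectories exists, and its law satisfies the FKG inequality. -/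
theorem exists_isPoissonPointProcess_satisfiesFKG (hK_zero : K 0 = ∅) (hK : Monotone K)
    (hK_exh : ∀ x, ∃ n, x ∈ K n) :
    ∃ P : Measure N.Configuration,
      IsPoissonPointProcess (N.intensity K) (fun ω : N.Configuration => ω.1) P ∧
        SatisfiesFKG P := by
  have := N.isFiniteMeasure_restrict_shell hK
  have hm := N.measurable_shellConfiguration hK hK_exh
  have h := isPoissonPointProcess_superposition (N.intensity K)
    (fun _ => N.measurableSet_shell _) (N.pairwise_disjoint_shell hK)
    (N.iUnion_shell hK_zero hK_exh)
  set Q := Measure.infinitePi fun n => poissonLaw ((N.intensity K).restrict (N.shell K n))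
  refine ⟨Q.map (N.shellConfiguration hK hK_exh), ?_,
    (satisfiesFKG_infinitePi_poissonLaw (N.intensity K)).map hm
      (N.monotone_shellConfiguration hK hK_exh)⟩
  exact IsPoissonPointProcess.map h hm measurable_subtype_coe

end Intensity

end WeightedNetwork

theorem mainTheorem6 {V : Type*} [Nontrivial V] [Countable V] [MeasurableSpace V]
    [DiscreteMeasurableSpace V] (N : WeightedNetwork V) (hN : N.IsTransient)
    (K : ℕ → Finset V) (hK_zero : K 0 = ∅) (hK_mono : Monotone K) (hK_exh : ∀ x, ∃ n, x ∈ K n) :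
    (∃! P : Measure N.Configuration,
      IsPoissonPointProcess (N.intensity K) (fun ω : N.Configuration => ω.1) P) ∧
    ∀ P : Measure N.Configuration,
      IsPoissonPointProcess (N.intensity K) (fun ω : N.Configuration => ω.1) P →
        SatisfiesFKG P ∧
        VariableSatisfiesFKG N.interlacementSet P ∧
        VariableSatisfiesFKG N.vacantSet P ∧
        VariableSatisfiesFKG N.trajectoryCount P ∧
        VariableSatisfiesFKG N.localTime P := by
  obtain ⟨P₀, hP₀, hFKG⟩ := N.exists_isPoissonPointProcess_satisfiesFKG hK_zero hK_mono hK_exh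
  refine ⟨⟨P₀, hP₀, fun P hP => N.law_unique hP hP₀⟩, fun P hP => ?_⟩
  obtain rfl := N.law_unique hP hP₀
  have := hP.isProbabilityMeasure
  exact ⟨hFKG,
    ⟨N.measurable_interlacementSet,
      hFKG.map N.measurable_interlacementSet N.monotone_interlacementSet⟩,
    ⟨N.measurable_vacantSet, hFKG.map_antitone N.measurable_vacantSet N.antitone_vacantSet⟩,
    ⟨N.measurable_trajectoryCount,
      hFKG.map N.measurable_trajectoryCount N.monotone_trajectoryCount⟩,
    ⟨N.measurable_localTime, hFKG.map N.measurable_localTime N.monotone_localTime⟩⟩
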